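/- **Setting.** A qubit $A$ with basis $|0\rangle$ (ground), $|1\rangle$ (excited), $\sigma_+=|1\rangle\langle0|$, $\sigma_-=|0\rangle\langle1|$, $\sigma_z=|1\rangle\langle1|-|0\rangle\langle0|$, and a single bosonic mode $B$ with annihilation operator $a$ have the Hamiltonian ($\hbar=1$) $$H_{AB}=H_A+g(\sigma_+a+\sigma_-a^\dagger)+H_B,\qquad H_A=\omega_A\sigma_+\sigma_-,\quad H_B=\omega_Ba^\dagger a,$$ with $g\in\mathbb R$ arbitrary, $\omega_A\in\mathbb R\setminus\{0\}$, $\omega_B>0$. Let $w[H,\beta]=e^{-\beta H}/\mathrm{Tr}\,e^{-\beta H}$. Initially $\rho_{AB}(0)=\rho_A(0)\otimes w[H_B,\beta_B]$ with $\beta_B>0$ and $\rho_A(0)$ an arbitrary qubit density matrix. Put $\rho_{AB}(t)=e^{-itH_{AB}}\rho_{AB}(0)e^{itH_{AB}}$ for $t\in\mathbb R$, with reduced states $\rho_A(t)$, $\rho_B(t)$, and let $S_A(t)=-\mathrm{Tr}[\rho_A(t)\ln\rho_A(t)]$, $E_B(t)=\mathrm{Tr}[\rho_B(t)H_B]$,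 $\dot E_B(t)=\mathrm{Tr}[\dot\rho_B(t)H_B]$. Let $\Delta=\omega_A-\omega_B$, $\Omega_n=\sqrt{\Delta^2+4g^2n}$, $p_n=e^{-n\beta_B\omega_B}/Z$ with $Z=\sum_{n\ge0}e^{-n\beta_B\omega_B}$, and (terms with $\Delta/\Omega_n$ being read as $0$ when $\Omega_n=0$) $$c_n(t)=\cos\tfrac{\Omega_nt}2-i\tfrac{\Delta}{\Omega_n}\sin\tfrac{\Omega_nt}2,\qquad \alpha=\sum_{n\ge0}p_n|c_n|^2,\quad \beta=\sum_{n\ge0}p_n|c_{n+1}|^2,\quad \gamma=\sum_{n\ge0}p_ne^{-i\omega_Bt}c_nc_{n+1},$$ $$\gamma_1=\frac{\alpha\dot\beta-\dot\alpha\beta-\dot\beta}{\alpha+\beta-1},\quad \gamma_2=\frac{\dot\alpha\beta-\alpha\dot\beta-\dot\alpha}{\alpha+\beta-1},\quad \gamma_3=-\tfrac12\big[\gamma_1+\gamma_2+2\,\mathrm{Re}(\dot\gamma/\gamma)\big],\quad \Omega_A=-\mathrm{Im}(\dot\gamma/\gamma).$$ Call $t$ *regular* if $\alpha(t)+\beta(t)-1\ne0$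 and $\gamma(t)\neq0$; for such $t$ define the generator $$\mathcal L_tX=-i\Omega_A[\sigma_+\sigma_-,X]+\gamma_1\big(\sigma_+X\sigma_--\tfrac12\{\sigma_-\sigma_+,X\}\big)+\gamma_2\big(\sigma_-X\sigma_+-\tfrac12\{\sigma_+\sigma_-,X\}\big)+\tfrac12\gamma_3(\sigma_zX\sigma_z-X).$$ A *fixed state* of $\mathcal L_t$ is a density matrix $\tau$ with $\mathcal L_t\tau=0$. Finally, let $$\sigma^{Es}(t)=\dot S_A(t)+\beta_B\dot E_B(t),\qquad \sigma_\tau(t)=-\mathrm{Tr}\big[\dot\rho_A(t)(\ln\rho_A(t)-\ln\tau)\big],\qquad w_A=w\big[H_A,\beta_B\omega_B/\omega_A\big].$$ The fixed-point rate $\sigma^{fp}(t)$ is $\sigma_\tau(t)$ with $\tau=\rho_A^{fp}(t)$ the instantaneous fixed point. **Theorem.** 1. *(Well-definedness.)* The power series for the matrix elements of $e^{-itH_{AB}}$ and $e^{-\beta_BH_B}$ in the Fock basis, and the series for $\mathrm{Tr}\,e^{-\beta_BH_B}$, for $\rho_A(t)$, for $E_B(t)$ and for $\dot E_B(t)$ converge;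 $\alpha,\beta,\gamma$ and the entries of $\rho_A,\rho_B$ are differentiable; $\frac{d}{dt}E_B(t)=\mathrm{Tr}[\dot\rho_B(t)H_B]$; and $S_A$ is differentiable at every $t$ at which $\rho_A(t)$ is positive definite. 2. *(Master equation.)* $\dot\rho_A(t)=\mathcal L_t\rho_A(t)$ at every regular $t$. 3. *(Ratio of rates.)* If $\alpha(t)+\beta(t)-1\ne0$, then $\gamma_1(t)=e^{-\omega_B\beta_B}\gamma_2(t)$; hence $\gamma_1(t)/\gamma_2(t)=e^{-\omega_B\beta_B}$ if also $\gamma_2(t)\neq0$. 4. *(Fixed point.)* At every regular $t$, the time-independent thermal state $w_A$ is a fixed state of $\mathcal L_t$. If moreover $\gamma_2(t)\ne0$, then $w_A=\frac{\gamma_1(t)}{\gamma_1(t)+\gamma_2(t)}|1\rangle\langle1|+\frac{\gamma_2(t)}{\gamma_1(t)+\gamma_2(t)}|0\rangle\langle0|=\rho_A^{fp}(t)$, and it is the only diagonal fixed state. If $\dot\gamma(t)\neq0$, every fixed state is diagonal. 5. *(Equality of the entropy production rates.)* At every $t$ at which $\rho_A(t)$ is positive definite, $\sigma^{Es}(t)=\sigma_{w_A}(t)$.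 If moreover $t$ is regular, then $\sigma^{Es}(t)=\sigma_\tau(t)$ for every positive definite diagonal fixed state $\tau$ of $\mathcal L_t$. Thus $\sigma^{Es}=\sigma^{fp}$, at all coupling strengths $g$. -/

import Mathlib

open scoped Matrix Kronecker Nat ComplexOrder

noncomputable section

namespace JC

/-! ### Operators written as (possibly infinite) matrices in an orthonormal basis -/

/-- Product of two matrices over arbitrary index sets. In every use below at least one of the two
factors has finitely supported rows or columns, so that the sum is finite. -/
def opMul {l m n : Type*} (A : Matrix l m ℂ) (B : Matrix m n ℂ) : Matrix l n ℂ :=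
  Matrix.of fun i k => ∑' j, A i j * B j k

/-- Powers for `opMul`. -/
def opPow {n : Type*} [DecidableEq n] (A : Matrix n n ℂ) : ℕ → Matrix n n ℂ
  | 0 => 1
  | k + 1 => opMul (opPow A k) A

/-- The terms of the exponential series of `A`, entry by entry. -/
def opExpTerm {n : Type*} [DecidableEq n] (A : Matrix n n ℂ) (i j : n) (k : ℕ) : ℂ :=
  ((k ! : ℕ) : ℂ)⁻¹ * opPow A k i j

/-- The exponential `e^A`, entry by entry: `⟨i|e^A|j⟩ = ∑ₖ ⟨i|Aᵏ|j⟩ / k!`. It is used for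
operators for which every basis vector is an entire analytic vector. -/
def opExp {n : Type*} [DecidableEq n] (A : Matrix n n ℂ) : Matrix n n ℂ :=
  Matrix.of fun i j => ∑' k, opExpTerm A i j k

/-- Trace over an arbitrary index set. -/
def opTrace {n : Type*} (A : Matrix n n ℂ) : ℂ := ∑' i, A i i

/-- Partial trace over the mode `B`. -/
def traceB (ρ : Matrix (Fin 2 × ℕ) (Fin 2 × ℕ) ℂ) : Matrix (Fin 2) (Fin 2) ℂ :=
  Matrix.of fun i j => ∑' n, ρ (i, n) (j, n)

/-- Partial trace over the qubit `A`. -/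
def traceA (ρ : Matrix (Fin 2 × ℕ) (Fin 2 × ℕ) ℂ) : Matrix ℕ ℕ ℂ :=
  Matrix.of fun m n => ∑ i, ρ (i, m) (i, n)

/-- Entrywise time derivative of a matrix-valued function. -/
def rate {m n : Type*} (ρ : ℝ → Matrix m n ℂ) (t : ℝ) : Matrix m n ℂ :=
  Matrix.of fun i j => deriv (fun s => ρ s i j) t

/-! ### Qubit (index `1` is the excited state, index `0` the ground state) and mode -/

/-- `σ₊ = |1⟩⟨0|`. -/
def σp : Matrix (Fin 2) (Fin 2) ℂ := !![0, 0; 1, 0]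

/-- `σ₋ = |0⟩⟨1|`. -/
def σm : Matrix (Fin 2) (Fin 2) ℂ := !![0, 1; 0, 0]

/-- `σ_z = |1⟩⟨1| - |0⟩⟨0|`. -/
def σz : Matrix (Fin 2) (Fin 2) ℂ := !![-1, 0; 0, 1]

/-- The annihilation operator in the Fock basis: `a|n⟩ = √n |n-1⟩`. -/
def ann : Matrix ℕ ℕ ℂ := Matrix.of fun m n => if m + 1 = n then ((Real.sqrt n : ℝ) : ℂ) else 0

/-- The matrix logarithm, by functional calculus (meaningful for positive definite `ρ`). -/
def logm (ρ : Matrix (Fin 2) (Fin 2) ℂ) : Matrix (Fin 2) (Fin 2) ℂ := cfc Real.log ρ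

/-- The von Neumann entropy `-Tr[ρ ln ρ]`. -/
def entropy (ρ : Matrix (Fin 2) (Fin 2) ℂ) : ℂ := -(ρ * logm ρ).trace

/-- The thermal state `w[H, β] = e^{-βH} / Tr[e^{-βH}]` of the qubit. -/
def thermalA (H : Matrix (Fin 2) (Fin 2) ℂ) (β : ℝ) : Matrix (Fin 2) (Fin 2) ℂ :=
  (NormedSpace.exp (-(β : ℂ) • H)).trace⁻¹ • NormedSpace.exp (-(β : ℂ) • H)

/-- The thermal state `w[H, β] = e^{-βH} / Tr[e^{-βH}]` of the mode. -/
def thermalB (H : Matrix ℕ ℕ ℂ) (β : ℝ) : Matrix ℕ ℕ ℂ :=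
  (opTrace (opExp (-(β : ℂ) • H)))⁻¹ • opExp (-(β : ℂ) • H)

/-- A density matrix of the qubit. -/
def IsState (ρ : Matrix (Fin 2) (Fin 2) ℂ) : Prop := ρ.PosSemidef ∧ ρ.trace = 1

/-- A state annihilated by the generator `L`. -/
def IsFixedPoint (L : Matrix (Fin 2) (Fin 2) ℂ → Matrix (Fin 2) (Fin 2) ℂ)
    (τ : Matrix (Fin 2) (Fin 2) ℂ) : Prop := IsState τ ∧ L τ = 0

/-! ### The Jaynes–Cummings model -/

/-- Qubit frequency, mode frequency, coupling strength, initial inverse temperature of the mode. -/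
structure Params where
  ωA : ℝ
  ωB : ℝ
  g : ℝ
  βB : ℝ

namespace Params

variable (P : Params)

/-- `H_A = ω_A σ₊σ₋`. -/
def HA : Matrix (Fin 2) (Fin 2) ℂ := (P.ωA : ℂ) • (σp * σm)

/-- `H_B = ω_B a†a`. -/
def HB : Matrix ℕ ℕ ℂ := (P.ωB : ℂ) • opMul annᴴ ann

/-- `H_AB = H_A + g (σ₊ a + σ₋ a†) + H_B`. -/
def HAB : Matrix (Fin 2 × ℕ) (Fin 2 × ℕ) ℂ :=
  P.HA ⊗ₖ (1 : Matrix ℕ ℕ ℂ) + (P.g : ℂ) • (σp ⊗ₖ ann + σm ⊗ₖ annᴴ)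
    + (1 : Matrix (Fin 2) (Fin 2) ℂ) ⊗ₖ P.HB

/-- `U(t) = e^{-i t H_AB}` (with `ħ = 1`). -/
def U (t : ℝ) : Matrix (Fin 2 × ℕ) (Fin 2 × ℕ) ℂ := opExp (-(Complex.I * t) • P.HAB)

/-- `ρ_AB(t) = U(t) (ρ_A(0) ⊗ w[H_B, β_B]) U(t)†`. -/
def ρAB (ρ₀ : Matrix (Fin 2) (Fin 2) ℂ) (t : ℝ) : Matrix (Fin 2 × ℕ) (Fin 2 × ℕ) ℂ :=
  opMul (opMul (P.U t) (ρ₀ ⊗ₖ thermalB P.HB P.βB)) (P.U t)ᴴ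

/-- The state of the qubit at time `t`. -/
def ρA (ρ₀ : Matrix (Fin 2) (Fin 2) ℂ) (t : ℝ) : Matrix (Fin 2) (Fin 2) ℂ :=
  traceB (P.ρAB ρ₀ t)

/-- The state of the mode at time `t`. -/
def ρB (ρ₀ : Matrix (Fin 2) (Fin 2) ℂ) (t : ℝ) : Matrix ℕ ℕ ℂ :=
  traceA (P.ρAB ρ₀ t)

/-- The energy `E_B(t) = Tr[ρ_B(t) H_B]`. -/
def EB (ρ₀ : Matrix (Fin 2) (Fin 2) ℂ) (t : ℝ) : ℂ := opTrace (opMul (P.ρB ρ₀ t) P.HB)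

/-- The energy rate `Ė_B(t) = Tr[ρ̇_B(t) H_B]`. -/
def EBrate (ρ₀ : Matrix (Fin 2) (Fin 2) ℂ) (t : ℝ) : ℂ :=
  opTrace (opMul (rate (P.ρB ρ₀) t) P.HB)

/-- The entropy production rate `σ^Es(t) = Ṡ_A(t) + β_B Ė_B(t)`. -/
def σEs (ρ₀ : Matrix (Fin 2) (Fin 2) ℂ) (t : ℝ) : ℂ :=
  deriv (fun s => entropy (P.ρA ρ₀ s)) t + P.βB * P.EBrate ρ₀ t

/-- `-Tr[ρ̇_A(t) (ln ρ_A(t) - ln τ)]`, which is `σ^fp(t)` when `τ` is the instantaneous fixed point. -/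
def σfp (ρ₀ τ : Matrix (Fin 2) (Fin 2) ℂ) (t : ℝ) : ℂ :=
  -(rate (P.ρA ρ₀) t * (logm (P.ρA ρ₀ t) - logm τ)).trace

/-! ### The exact time-local master equation -/

/-- Detuning. -/
def Δ : ℝ := P.ωA - P.ωB

/-- `Ω_n = √(Δ² + 4 g² n)`. -/
def Ω (n : ℕ) : ℝ := Real.sqrt (P.Δ ^ 2 + 4 * P.g ^ 2 * n)

/-- `Z = ∑ₙ e^{-n β_B ω_B}`. -/
def Z : ℝ := ∑' n : ℕ, Real.exp (-(n * P.βB * P.ωB))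

/-- The occupation probabilities `p_n = e^{-n β_B ω_B} / Z`. -/
def p (n : ℕ) : ℝ := Real.exp (-(n * P.βB * P.ωB)) / P.Z

/-- `cos(Ω_n t/2) - i (Δ/Ω_n) sin(Ω_n t/2)`; if `Ω_n = 0` then also `Δ = 0`, and the second
term is `0`, its limiting value. -/
def amp (n : ℕ) (t : ℝ) : ℂ :=
  (Real.cos (P.Ω n * t / 2) : ℂ) - Complex.I * ((P.Δ / P.Ω n * Real.sin (P.Ω n * t / 2) : ℝ) : ℂ)

/-- `cos²(Ω_n t/2) + (Δ²/Ω_n²) sin²(Ω_n t/2)`. -/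
def surv (n : ℕ) (t : ℝ) : ℝ :=
  Real.cos (P.Ω n * t / 2) ^ 2 + P.Δ ^ 2 / P.Ω n ^ 2 * Real.sin (P.Ω n * t / 2) ^ 2

def α (t : ℝ) : ℝ := ∑' n, P.p n * P.surv n t

def β (t : ℝ) : ℝ := ∑' n, P.p n * P.surv (n + 1) t

def γ (t : ℝ) : ℂ :=
  ∑' n, (P.p n : ℂ) * Complex.exp (-(Complex.I * P.ωB * t)) * P.amp n t * P.amp (n + 1) t

def γ₁ (t : ℝ) : ℝ :=
  (P.α t * deriv P.β t - deriv P.α t * P.β t - deriv P.β t) / (P.α t + P.β t - 1)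

def γ₂ (t : ℝ) : ℝ :=
  (deriv P.α t * P.β t - P.α t * deriv P.β t - deriv P.α t) / (P.α t + P.β t - 1)

def γ₃ (t : ℝ) : ℝ := -(1 / 2) * (P.γ₁ t + P.γ₂ t + 2 * (deriv P.γ t / P.γ t).re)

def ΩA (t : ℝ) : ℝ := -(deriv P.γ t / P.γ t).im

/-- The times at which the coefficients of the master equation are defined. -/
def Regular (t : ℝ) : Prop := P.α t + P.β t - 1 ≠ 0 ∧ P.γ t ≠ 0

/-- The generator `𝓛_t` of the dynamics of the qubit. -/
def L (t : ℝ) (X : Matrix (Fin 2) (Fin 2) ℂ) : Matrix (Fin 2) (Fin 2) ℂ :=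
  -(Complex.I * P.ΩA t) • (σp * σm * X - X * (σp * σm))
  + (P.γ₁ t : ℂ) • (σp * X * σm - (1 / 2 : ℂ) • (σm * σp * X + X * (σm * σp)))
  + (P.γ₂ t : ℂ) • (σm * X * σp - (1 / 2 : ℂ) • (σp * σm * X + X * (σp * σm)))
  + (1 / 2 * P.γ₃ t : ℂ) • (σz * X * σz - X)

/-- `ρ_A^fp(t) = (γ₁|1⟩⟨1| + γ₂|0⟩⟨0|) / (γ₁ + γ₂)`, meaningful when `γ₁(t) + γ₂(t) ≠ 0`. -/
def ρfp (t : ℝ) : Matrix (Fin 2) (Fin 2) ℂ :=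
  Matrix.diagonal ![((P.γ₂ t / (P.γ₁ t + P.γ₂ t) : ℝ) : ℂ), ((P.γ₁ t / (P.γ₁ t + P.γ₂ t) : ℝ) : ℂ)]

/-- The thermal state `w[H_A, β_B ω_B / ω_A]` of the qubit. -/
def wA : Matrix (Fin 2) (Fin 2) ℂ := thermalA P.HA (P.βB * P.ωB / P.ωA)

end Params

end JC

end

/-!
The interaction conserves the excitation number `a†a + σ₊σ₋`, so `H_AB` splits into the blocks
spanned by `|0,n⟩` and `|1,n-1⟩` (and the single state `|0,0⟩`). On the `n`-th block the eigenvalues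
are `ω_B n + (Δ ± Ω_n)/2`; hence the powers of `-itH_AB`, and then its exponential series, are
explicit (`opPow_HAB`, `hasSum_U`). Up to phases the entries of `U(t)` are `c_n`, its conjugate and
a transition amplitude of modulus squared `1 - |c_n|²`.

Since the initial state of the mode is diagonal with geometric weights, `p_{n+1} = q p_n` for
`q = e^{-ω_Bβ_B}`, all populations and energies depend on time through `1 - α` alone. Put
`κ = ρ₀₀(0) - ρ₁₁(0)/q` (`imbalance`). The excited population of the qubit is `ρ₁₁(0) + κ(1 - α)`,
its coherence is `ρ₁₀(0)γ` (`ρA_eq`), and the energy of the mode is `const - ω_B κ(1 - α)`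
(`hasSum_energy`), by summation by parts of the flux of excitations between neighbouring levels. The
series may be differentiated term by term because `Ω_n` grows at most linearly and `p_n` decays
geometrically.

The same geometric weights and the stationarity of `|0,0⟩` give `α = 1 - q + qβ` (`α_eq`), from
which `γ₁ = qγ₂` (`γ₁_eq`). So the populations `1/(1+q)` and `q/(1+q)` of `w_A` are balanced, and
the populations and the coherence obey the master equation (`rate_ρA_eq_L`).

For the entropy, `ln ρ` is an affine function of a qubit state `ρ` because the spectrum has at most
two points, and `Ṡ = -Tr[ρ̇ ln ρ]` (`hasDerivAt_entropy`). Finally `Tr[ρ̇ ln w_A] = -ω_Bβ_B ρ̇₁₁`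
as `ln w_A` has the level difference `ln q`, while `Ė_B = -ω_B ρ̇₁₁`; this is the equality of the
two entropy production rates. A diagonal fixed state other than `w_A` exists only if `γ₂ = γ₁ = 0`,
when `ρ̇₁₁ = 0` and the choice of `τ` does not matter.
-/

open scoped Matrix Kronecker Nat ComplexOrder

noncomputable section

namespace JC

/-! ### Excitation-conserving operators -/

/-- A complex symmetric operator commuting with the excitation number `a†a + σ₊σ₋`, given by its
entries `x n = ⟨0,n|·|0,n⟩`, `y n = ⟨1,n|·|1,n⟩` and `z n = ⟨0,n+1|·|1,n⟩ = ⟨1,n|·|0,n+1⟩`. -/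
def ladder (x y z : ℕ → ℂ) : Matrix (Fin 2 × ℕ) (Fin 2 × ℕ) ℂ :=
  Matrix.of fun i j =>
    ![![if i.2 = j.2 then x j.2 else 0, if i.2 = j.2 + 1 then z j.2 else 0],
      ![if i.2 + 1 = j.2 then z i.2 else 0, if i.2 = j.2 then y j.2 else 0]] i.1 j.1

section ladder
variable (x y z : ℕ → ℂ)

@[simp] lemma ladder_zero_zero (m n : ℕ) :
    ladder x y z (0, m) (0, n) = if m = n then x n else 0 := rfl
@[simp] lemma ladder_one_one (m n : ℕ) :
    ladder x y z (1, m) (1, n) = if m = n then y n else 0 := rfl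
@[simp] lemma ladder_zero_one (m n : ℕ) :
    ladder x y z (0, m) (1, n) = if m = n + 1 then z n else 0 := rfl
@[simp] lemma ladder_one_zero (m n : ℕ) :
    ladder x y z (1, m) (0, n) = if m + 1 = n then z m else 0 := rfl

lemma conjTranspose_ladder :
    (ladder x y z)ᴴ = ladder (star x) (star y) (star z) := by
  ext ⟨i, m⟩ ⟨j, n⟩
  fin_cases i <;> fin_cases j <;>
    simp [Matrix.conjTranspose_apply, apply_ite (starRingEnd ℂ), eq_comm] <;>
    split_ifs with h <;> simp [h]

lemma smul_ladder (c : ℂ) : c • ladder x y z = ladder (c • x) (c • y) (c • z) := by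
  ext ⟨i, m⟩ ⟨j, n⟩
  fin_cases i <;> fin_cases j <;> simp

variable {x y z} {l : Type*} (X : Matrix l (Fin 2 × ℕ) ℂ) (i : l)

lemma opMul_ladder_zero_zero : opMul X (ladder x y z) i (0, 0) = X i (0, 0) * x 0 := by
  simp only [opMul, Matrix.of_apply]
  rw [tsum_eq_single (0, 0)]
  · simp
  · rintro ⟨j, m⟩ h
    fin_cases j
    · have : m ≠ 0 := fun h' => h (by simp [h'])
      simp [this]
    · simp

lemma opMul_ladder_zero_succ (n : ℕ) : opMul X (ladder x y z) i (0, n + 1) =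
    X i (0, n + 1) * x (n + 1) + X i (1, n) * z n := by
  simp only [opMul, Matrix.of_apply]
  rw [tsum_eq_sum (s := {(0, n + 1), (1, n)})]
  · rw [Finset.sum_pair (by simp)]
    simp
  · rintro ⟨j, m⟩ h
    fin_cases j <;> simp at h <;> simp [h]

lemma opMul_ladder_one (n : ℕ) : opMul X (ladder x y z) i (1, n) =
    X i (1, n) * y n + X i (0, n + 1) * z n := by
  simp only [opMul, Matrix.of_apply]
  rw [tsum_eq_sum (s := {(1, n), (0, n + 1)})]
  · rw [Finset.sum_pair (by simp)]
    simp
  · rintro ⟨j, m⟩ h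
    fin_cases j <;> simp at h <;> simp [h]

end ladder

/-- The exponential series of an operator all of whose powers conserve the excitation number. -/
lemma hasSum_opExpTerm_ladder {A : Matrix (Fin 2 × ℕ) (Fin 2 × ℕ) ℂ} {x y z : ℕ → ℕ → ℂ}
    {X Y Z : ℕ → ℂ} (hA : ∀ k, opPow A k = ladder (x k) (y k) (z k))
    (hx : ∀ n, HasSum (fun k => ((k ! : ℕ) : ℂ)⁻¹ * x k n) (X n))
    (hy : ∀ n, HasSum (fun k => ((k ! : ℕ) : ℂ)⁻¹ * y k n) (Y n))
    (hz : ∀ n, HasSum (fun k => ((k ! : ℕ) : ℂ)⁻¹ * z k n) (Z n)) (i j : Fin 2 × ℕ) :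
    HasSum (opExpTerm A i j) (ladder X Y Z i j) := by
  unfold opExpTerm
  simp only [hA]
  obtain ⟨i, m⟩ := i
  obtain ⟨j, n⟩ := j
  fin_cases i <;> fin_cases j <;> simp only [Fin.zero_eta, Fin.mk_one, ladder_zero_zero,
    ladder_one_one, ladder_zero_one, ladder_one_zero] <;> split_ifs <;>
    simp only [mul_zero, hasSum_zero, hx, hy, hz]

lemma hasSum_of_eq {f g : ℕ → ℂ} {a b : ℂ} (h : HasSum g b) (hf : ∀ k, f k = g k) (ha : a = b) :
    HasSum f a := by
  rw [ha, funext hf]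
  exact h

lemma hasSum_exp (μ : ℂ) : HasSum (fun k : ℕ => ((k ! : ℕ) : ℂ)⁻¹ * μ ^ k) (Complex.exp μ) := by
  rw [Complex.exp_eq_exp_ℂ]
  have := NormedSpace.expSeries_div_hasSum_exp (𝔸 := ℂ) μ
  simpa [div_eq_inv_mul] using this

/-! ### Diagonal operators -/

lemma opMul_diagonal {l m : Type*} [DecidableEq m] (X : Matrix l m ℂ) (d : m → ℂ) (i : l) (j : m) :
    opMul X (Matrix.diagonal d) i j = X i j * d j := by
  simp only [opMul, Matrix.of_apply]
  rw [tsum_eq_single j]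
  · simp
  · intro k h
    simp [h]

lemma opPow_diagonal {m : Type*} [DecidableEq m] (d : m → ℂ) (k : ℕ) :
    opPow (Matrix.diagonal d) k = Matrix.diagonal (d ^ k) := by
  induction k with
  | zero => simp [opPow]
  | succ k ih =>
    ext i j
    rw [opPow, opMul_diagonal, ih]
    by_cases h : i = j
    · subst h; simp [pow_succ]
    · simp [h]

lemma hasSum_opExpTerm_diagonal {m : Type*} [DecidableEq m] (d : m → ℂ) (i j : m) :
    HasSum (opExpTerm (Matrix.diagonal d) i j)
      (Matrix.diagonal (fun n => Complex.exp (d n)) i j) := by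
  unfold opExpTerm
  simp only [opPow_diagonal]
  by_cases h : i = j
  · subst h; simpa using hasSum_exp (d i)
  · simp [h, hasSum_zero]

lemma opMul_kronecker_diagonal {l : Type*} (X : Matrix l (Fin 2 × ℕ) ℂ)
    (ρ : Matrix (Fin 2) (Fin 2) ℂ) (d : ℕ → ℂ) (i : l) (j : Fin 2) (n : ℕ) :
    opMul X (ρ ⊗ₖ Matrix.diagonal d) i (j, n) =
      (X i (0, n) * ρ 0 j + X i (1, n) * ρ 1 j) * d n := by
  simp only [opMul, Matrix.of_apply]
  rw [tsum_eq_sum (s := {(0, n), (1, n)})]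
  · rw [Finset.sum_pair (by simp)]
    simp
    ring
  · rintro ⟨k, m⟩ h
    fin_cases k <;> simp at h <;> simp [h]

lemma opMul_ann : opMul annᴴ ann = Matrix.diagonal (fun n : ℕ => (n : ℂ)) := by
  ext m n
  simp only [opMul, Matrix.of_apply, ann, Matrix.conjTranspose_apply]
  rcases n with _ | n
  · rw [tsum_eq_single 0]
    · rcases m with _ | m <;> simp
    · intro k hk; simp
  · rw [tsum_eq_single n]
    · by_cases h : m = n + 1
      · subst h
        simp only [if_true, Matrix.diagonal_apply_eq, Complex.star_def, Complex.conj_ofReal]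
        rw [← Complex.ofReal_mul, Real.mul_self_sqrt (by positivity)]
        simp
      · rw [Matrix.diagonal_apply_ne _ h, if_neg (Ne.symm h)]; simp
    · intro k hk; simp [hk]

namespace Params

variable (P : Params)

lemma HB_eq : P.HB = Matrix.diagonal (fun n : ℕ => (P.ωB : ℂ) * n) := by
  rw [HB, opMul_ann]
  ext i j
  by_cases h : i = j
  · subst h; simp
  · simp [h]

lemma HAB_eq : P.HAB = ladder (fun n => P.ωB * n) (fun n => P.ωA + P.ωB * n)
    (fun n => P.g * (Real.sqrt (n + 1) : ℝ)) := by
  rw [HAB, HB_eq, HA]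
  ext ⟨i, m⟩ ⟨j, n⟩
  fin_cases i <;> fin_cases j <;>
    simp [σp, σm, ann, Matrix.one_apply, Matrix.diagonal_apply, Matrix.conjTranspose_apply]
  · split_ifs with h
    · subst h; simp
    · rfl
  · by_cases h : n + 1 = m
    · subst h; simp
    · simp [h, Ne.symm h]
  · by_cases h : m + 1 = n
    · subst h; simp
    · simp [h]
  · by_cases h : m = n <;> simp [h]

/-! ### The time evolution operator -/

lemma Ω_sq (n : ℕ) : P.Ω n ^ 2 = P.Δ ^ 2 + 4 * P.g ^ 2 * n :=
  Real.sq_sqrt (by positivity)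

lemma Ω_nonneg (n : ℕ) : 0 ≤ P.Ω n := Real.sqrt_nonneg _

lemma Δ_eq_zero {n : ℕ} (h : P.Ω n = 0) : P.Δ = 0 := by
  have := P.Ω_sq n
  rw [h] at this
  have h2 : 0 ≤ 4 * P.g ^ 2 * n := by positivity
  nlinarith [sq_nonneg P.Δ]

lemma coupling_eq_zero {n : ℕ} (h : P.Ω n = 0) : P.g * Real.sqrt n = 0 := by
  have := P.Ω_sq n
  rw [h, P.Δ_eq_zero h] at this
  have h2 : (P.g * Real.sqrt n) ^ 2 = 0 := by
    rw [mul_pow, Real.sq_sqrt (by positivity)]; linarith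
  exact pow_eq_zero_iff (two_ne_zero) |>.1 h2

/-- The eigenvalues `ω_B n + (Δ ± Ω_n)/2` of `H_AB` on the span of `|0,n⟩` and `|1,n-1⟩`; the sign
is `s = ±1`. -/
def energy (s : ℝ) (n : ℕ) : ℂ := P.ωB * n + (P.Δ + s * P.Ω n) / 2

/-- Half the sum of the `k`-th powers of the two eigenvalues of `-itH_AB` in the `n`-th block. -/
def evenPow (t : ℝ) (k n : ℕ) : ℂ :=
  ((-(Complex.I * t) * P.energy 1 n) ^ k + (-(Complex.I * t) * P.energy (-1) n) ^ k) / 2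

/-- Half the difference of the `k`-th powers of the two eigenvalues of `-itH_AB` in the `n`-th
block, divided by `Ω_n`. -/
def oddPow (t : ℝ) (k n : ℕ) : ℂ :=
  ((-(Complex.I * t) * P.energy 1 n) ^ k - (-(Complex.I * t) * P.energy (-1) n) ^ k) / 2 / P.Ω n

lemma evenPow_succ (t : ℝ) (k n : ℕ) : P.evenPow t (k + 1) n = -(Complex.I * t) *
    ((P.ωB * n + P.Δ / 2) * P.evenPow t k n + P.Ω n ^ 2 / 2 * P.oddPow t k n) := by
  unfold evenPow oddPow
  by_cases h : P.Ω n = 0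
  · simp [energy, h, pow_succ]; ring
  · have h' : (P.Ω n : ℂ) ≠ 0 := by exact_mod_cast h
    field_simp
    simp only [energy, pow_succ]
    push_cast
    ring

/-- The coefficient `c` is either `Δ` or a multiple of `g√n`, which vanish with `Ω_n`; then also the
junk value of `oddPow` at `Ω_n = 0` obeys the recursion. -/
lemma oddPow_succ (t : ℝ) (k n : ℕ) {c : ℂ} (hc : P.Ω n = 0 → c = 0) :
    c * P.oddPow t (k + 1) n = -(Complex.I * t) *
      ((P.ωB * n + P.Δ / 2) * (c * P.oddPow t k n) + c * P.evenPow t k n / 2) := by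
  by_cases h : P.Ω n = 0
  · simp [hc h]
  · have h' : (P.Ω n : ℂ) ≠ 0 := by exact_mod_cast h
    unfold evenPow oddPow
    field_simp
    simp only [energy, pow_succ]
    push_cast
    ring

lemma opPow_HAB (t : ℝ) (k : ℕ) : opPow (-(Complex.I * t) • P.HAB) k =
    ladder (fun n => P.evenPow t k n - P.Δ * P.oddPow t k n)
      (fun n => P.evenPow t k (n + 1) + P.Δ * P.oddPow t k (n + 1))
      (fun n => 2 * ((P.g * Real.sqrt (n + 1 : ℕ) : ℝ) : ℂ) * P.oddPow t k (n + 1)) := by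
  have hΔ : ∀ n, P.Ω n = 0 → (P.Δ : ℂ) = 0 := fun n h => by rw [P.Δ_eq_zero h]; simp
  have hg : ∀ n, P.Ω n = 0 → 2 * ((P.g * Real.sqrt n : ℝ) : ℂ) = 0 :=
    fun n h => by rw [P.coupling_eq_zero h]; simp
  have hΩ : ∀ n : ℕ, (P.Ω n : ℂ) ^ 2 = P.Δ ^ 2 + 4 * ((P.g * Real.sqrt n : ℝ) : ℂ) ^ 2 := by
    intro n
    have : P.Ω n ^ 2 = P.Δ ^ 2 + 4 * (P.g * Real.sqrt n) ^ 2 := by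
      rw [mul_pow, Real.sq_sqrt (by positivity), P.Ω_sq]; ring
    exact_mod_cast this
  have hΔd : (P.Δ : ℂ) = P.ωA - P.ωB := by simp [Δ]
  induction k with
  | zero =>
    ext ⟨i, m⟩ ⟨j, n⟩
    fin_cases i <;> fin_cases j <;> simp [opPow, evenPow, oddPow, Matrix.one_apply]
  | succ k ih =>
    have key : ∀ n, P.evenPow t (k + 1) n - P.Δ * P.oddPow t (k + 1) n =
        (P.evenPow t k n - P.Δ * P.oddPow t k n) * (-(Complex.I * t) * (P.ωB * n)) +
        2 * ((P.g * Real.sqrt n : ℝ) : ℂ) * P.oddPow t k n *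
          (-(Complex.I * t) * ((P.g * Real.sqrt n : ℝ) : ℂ)) := by
      intro n
      rw [evenPow_succ, oddPow_succ _ _ _ _ (hΔ n), hΩ]
      ring
    have key1 : ∀ n : ℕ, P.evenPow t (k + 1) (n + 1) + P.Δ * P.oddPow t (k + 1) (n + 1) =
        (P.evenPow t k (n + 1) + P.Δ * P.oddPow t k (n + 1)) *
          (-(Complex.I * t) * (P.ωA + P.ωB * n)) +
        2 * ((P.g * Real.sqrt (n + 1 : ℕ) : ℝ) : ℂ) * P.oddPow t k (n + 1) *
          (-(Complex.I * t) * ((P.g * Real.sqrt (n + 1 : ℕ) : ℝ) : ℂ)) := by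
      intro n
      rw [evenPow_succ, oddPow_succ _ _ _ _ (hΔ (n + 1)), hΩ]
      have hA : (P.ωA : ℂ) = P.Δ + P.ωB := by rw [hΔd]; ring
      rw [hA]
      push_cast
      ring
    have key2 : ∀ n : ℕ, 2 * ((P.g * Real.sqrt (n + 1 : ℕ) : ℝ) : ℂ) * P.oddPow t (k + 1) (n + 1) =
        2 * ((P.g * Real.sqrt (n + 1 : ℕ) : ℝ) : ℂ) * P.oddPow t k (n + 1) *
          (-(Complex.I * t) * (P.ωB * (n + 1 : ℕ))) +
        (P.evenPow t k (n + 1) + P.Δ * P.oddPow t k (n + 1)) *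
          (-(Complex.I * t) * ((P.g * Real.sqrt (n + 1 : ℕ) : ℝ) : ℂ)) := by
      intro n
      rw [oddPow_succ _ _ _ _ (hg (n + 1))]
      push_cast
      ring
    have key3 : ∀ n : ℕ, 2 * ((P.g * Real.sqrt (n + 1 : ℕ) : ℝ) : ℂ) * P.oddPow t (k + 1) (n + 1) =
        2 * ((P.g * Real.sqrt (n + 1 : ℕ) : ℝ) : ℂ) * P.oddPow t k (n + 1) *
          (-(Complex.I * t) * (P.ωA + P.ωB * n)) +
        (P.evenPow t k (n + 1) - P.Δ * P.oddPow t k (n + 1)) *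
          (-(Complex.I * t) * ((P.g * Real.sqrt (n + 1 : ℕ) : ℝ) : ℂ)) := by
      intro n
      rw [oddPow_succ _ _ _ _ (hg (n + 1))]
      have hA : (P.ωA : ℂ) = P.Δ + P.ωB := by rw [hΔd]; ring
      rw [hA]
      push_cast
      ring
    rw [opPow, ih, HAB_eq, smul_ladder]
    ext ⟨i, m⟩ ⟨j, n⟩
    fin_cases j
    · rcases n with _ | n
      · simp only [Fin.zero_eta]
        rw [opMul_ladder_zero_zero]
        fin_cases i
        · by_cases h : m = 0
          · subst h
            simp [key]
          · simp [h]
        · simp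
      · simp only [Fin.zero_eta]
        rw [opMul_ladder_zero_succ]
        fin_cases i
        · by_cases h : m = n + 1
          · subst h
            simp [key]
          · simp [h]
        · by_cases h : m = n
          · subst h
            have := key2 m
            simp at this ⊢
            rw [this]
          · simp [h]
    · simp only [Fin.mk_one]
      rw [opMul_ladder_one]
      fin_cases i
      · by_cases h : m = n + 1
        · subst h
          have := key3 n
          simp at this ⊢
          rw [this]
        · simp [h]
      · by_cases h : m = n
        · subst h
          simp [key1]
        · simp [h]

/-- The phase common to the matrix elements of `U(t)` in the `n`-th block. -/
def phase (n : ℕ) (t : ℝ) : ℂ := Complex.exp (-(Complex.I * t) * (P.ωB * n + P.Δ / 2))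

/-- The amplitude, up to `phase`, of the transitions `|0,n⟩ ↔ |1,n-1⟩`; it vanishes if `Ω_n = 0`,
since then `g√n = 0`. -/
def hop (n : ℕ) (t : ℝ) : ℂ :=
  -(Complex.I * ((2 * (P.g * Real.sqrt n) / P.Ω n * Real.sin (P.Ω n * t / 2) : ℝ) : ℂ))

lemma exp_energy (s t : ℝ) (n : ℕ) : Complex.exp (-(Complex.I * t) * P.energy s n) =
    P.phase n t * Complex.exp (-((s * (P.Ω n * t / 2) : ℝ) : ℂ) * Complex.I) := by
  rw [phase, ← Complex.exp_add, energy]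
  congr 1
  push_cast
  ring

lemma hasSum_evenPow (t : ℝ) (n : ℕ) :
    HasSum (fun k => ((k ! : ℕ) : ℂ)⁻¹ * P.evenPow t k n)
      (P.phase n t * (Real.cos (P.Ω n * t / 2) : ℂ)) := by
  have := ((hasSum_exp (-(Complex.I * t) * P.energy 1 n)).add
    (hasSum_exp (-(Complex.I * t) * P.energy (-1) n))).div_const 2
  rw [exp_energy, exp_energy] at this
  refine hasSum_of_eq this (fun k => ?_) ?_
  · unfold evenPow; ring
  · rw [Complex.ofReal_cos, Complex.cos]; push_cast; ring_nf

/-- The division by `Ω_n` is harmless: if `Ω_n = 0`, both sides are `0`. -/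
lemma hasSum_oddPow (t : ℝ) (n : ℕ) :
    HasSum (fun k => ((k ! : ℕ) : ℂ)⁻¹ * P.oddPow t k n)
      (P.phase n t * -(Complex.I * ((Real.sin (P.Ω n * t / 2) / P.Ω n : ℝ) : ℂ))) := by
  have := (((hasSum_exp (-(Complex.I * t) * P.energy 1 n)).sub
    (hasSum_exp (-(Complex.I * t) * P.energy (-1) n))).div_const 2).div_const (P.Ω n : ℂ)
  rw [exp_energy, exp_energy] at this
  refine hasSum_of_eq this (fun k => ?_) ?_
  · unfold oddPow; ring
  · rw [Complex.ofReal_div, Complex.ofReal_sin, Complex.sin]; push_cast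
    generalize P.phase n t = f
    generalize (P.Ω n : ℂ)⁻¹ = w
    ring_nf
    simp
    ring

/-- The evolution operator as an excitation-conserving operator. -/
def evol (t : ℝ) : Matrix (Fin 2 × ℕ) (Fin 2 × ℕ) ℂ :=
  ladder (fun n => P.phase n t * star (P.amp n t)) (fun n => P.phase (n + 1) t * P.amp (n + 1) t)
    (fun n => P.phase (n + 1) t * P.hop (n + 1) t)

lemma hasSum_U (t : ℝ) (i j : Fin 2 × ℕ) :
    HasSum (opExpTerm (-(Complex.I * t) • P.HAB) i j) (P.evol t i j) := by
  refine hasSum_opExpTerm_ladder (P.opPow_HAB t) (fun n => ?_) (fun n => ?_) (fun n => ?_) i j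
  · refine hasSum_of_eq ((P.hasSum_evenPow t n).sub
      ((P.hasSum_oddPow t n).mul_left (P.Δ : ℂ))) (fun k => ?_) ?_
    · ring
    · simp only [amp, star_sub, Complex.star_def, map_mul, Complex.conj_ofReal, Complex.conj_I]
      push_cast
      ring
  · refine hasSum_of_eq ((P.hasSum_evenPow t (n + 1)).add
      ((P.hasSum_oddPow t (n + 1)).mul_left (P.Δ : ℂ))) (fun k => ?_) ?_
    · ring
    · simp [amp]; ring
  · refine hasSum_of_eq ((P.hasSum_oddPow t (n + 1)).mul_left
      (2 * ((P.g * Real.sqrt (n + 1 : ℕ) : ℝ) : ℂ))) (fun k => ?_) ?_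
    · ring
    · simp [hop]; ring

lemma U_eq (t : ℝ) : P.U t = P.evol t := by
  ext i j
  exact (P.hasSum_U t i j).tsum_eq

end Params

/-! ### The logarithm and the entropy of a qubit -/

/-- The length `r = √((ρ₁₁ - ρ₀₀)² + 4|ρ₁₀|²)` of the Bloch vector; the eigenvalues of a
Hermitian `ρ` of unit trace are `(1 ± r)/2`. -/
def bloch (ρ : Matrix (Fin 2) (Fin 2) ℂ) : ℝ :=
  Real.sqrt (((ρ 1 1).re - (ρ 0 0).re) ^ 2 + 4 * Complex.normSq (ρ 1 0))

lemma bloch_sq (ρ : Matrix (Fin 2) (Fin 2) ℂ) : bloch ρ ^ 2 =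
    ((ρ 1 1).re - (ρ 0 0).re) ^ 2 + 4 * Complex.normSq (ρ 1 0) :=
  Real.sq_sqrt (by have := Complex.normSq_nonneg (ρ 1 0); positivity)

lemma bloch_nonneg (ρ : Matrix (Fin 2) (Fin 2) ℂ) : 0 ≤ bloch ρ := Real.sqrt_nonneg _

/-- Entrywise form of being Hermitian with unit trace. -/
lemma entries_of_isHermitian_of_trace_eq_one {ρ : Matrix (Fin 2) (Fin 2) ℂ} (h : ρ.IsHermitian)
    (ht : ρ.trace = 1) : ρ 0 0 = ((ρ 0 0).re : ℂ) ∧ ρ 1 1 = ((ρ 1 1).re : ℂ) ∧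
      ρ 0 1 = star (ρ 1 0) ∧ (ρ 0 0).re + (ρ 1 1).re = 1 := by
  refine ⟨?_, ?_, (h.apply 0 1).symm, ?_⟩
  · have := h.apply 0 0
    exact (Complex.conj_eq_iff_re.1 this).symm
  · have := h.apply 1 1
    exact (Complex.conj_eq_iff_re.1 this).symm
  · rw [Matrix.trace_fin_two] at ht
    have := congrArg Complex.re ht
    simpa using this

lemma spectrum_qubit {ρ : Matrix (Fin 2) (Fin 2) ℂ} (h : ρ.IsHermitian) (ht : ρ.trace = 1)
    {x : ℝ} (hx : x ∈ spectrum ℝ ρ) : x = (1 + bloch ρ) / 2 ∨ x = (1 - bloch ρ) / 2 := by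
  obtain ⟨h0, h1, h01, htr⟩ := entries_of_isHermitian_of_trace_eq_one h ht
  rw [spectrum.mem_iff, Matrix.isUnit_iff_isUnit_det, isUnit_iff_ne_zero, not_not,
    Matrix.det_fin_two] at hx
  simp only [Matrix.sub_apply, Matrix.algebraMap_matrix_apply] at hx
  rw [h01, h0, h1] at hx
  have hn : star (ρ 1 0) * ρ 1 0 = (Complex.normSq (ρ 1 0) : ℂ) :=
    Complex.normSq_eq_conj_mul_self.symm
  have hx' : ((x - (ρ 0 0).re) * (x - (ρ 1 1).re) - Complex.normSq (ρ 1 0) : ℝ) = 0 := by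
    have : (((x - (ρ 0 0).re) * (x - (ρ 1 1).re) - Complex.normSq (ρ 1 0) : ℝ) : ℂ) = 0 := by
      push_cast
      rw [← hn, ← hx]
      simp
    exact_mod_cast this
  have hb := bloch_sq ρ
  have : (x - (1 + bloch ρ) / 2) * (x - (1 - bloch ρ) / 2) = 0 := by
    have e : (ρ 0 0).re = 1 - (ρ 1 1).re := by linarith
    rw [e] at hx' hb
    nlinarith
  rcases mul_eq_zero.1 this with h | h
  · left; linarith
  · right; linarith

/-- The slope of the affine function which interpolates `ln` at the eigenvalues `(1 ± r)/2`; if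
`r = 0` the junk value `0` is a correct choice. -/
def logSlope (r : ℝ) : ℝ := (Real.log ((1 + r) / 2) - Real.log ((1 - r) / 2)) / r

/-- The constant term of the affine function which interpolates `ln` at `(1 ± r)/2`. -/
def logConst (r : ℝ) : ℝ := Real.log ((1 + r) / 2) - logSlope r * ((1 + r) / 2)

lemma logConst_add (r : ℝ) :
    logConst r + logSlope r * ((1 - r) / 2) = Real.log ((1 - r) / 2) := by
  by_cases h : r = 0
  · simp [logConst, logSlope, h]
  · unfold logConst logSlope; field_simp; ring

/-- The logarithm is affine in `ρ`, since the spectrum has at most two points. -/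
lemma logm_eq {ρ : Matrix (Fin 2) (Fin 2) ℂ} (h : ρ.IsHermitian) (ht : ρ.trace = 1) :
    logm ρ = (logConst (bloch ρ) : ℂ) • 1 + (logSlope (bloch ρ) : ℂ) • ρ := by
  have hs : IsSelfAdjoint ρ := h
  have : logm ρ = cfc (fun x : ℝ => logConst (bloch ρ) + logSlope (bloch ρ) * x) ρ := by
    refine cfc_congr fun x hx => ?_
    rcases spectrum_qubit h ht hx with rfl | rfl
    · simp [logConst]
    · exact (logConst_add _).symm
  rw [this, cfc_const_add (R := ℝ) _ (fun x => logSlope (bloch ρ) * x) ρ,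
    cfc_const_mul_id (R := ℝ) _ ρ]
  ext i j
  simp [Matrix.algebraMap_matrix_apply, Matrix.one_apply]

/-- The binary entropy of the eigenvalues `(1 ± r)/2`. -/
def blochEntropy (r : ℝ) : ℝ := Real.negMulLog ((1 + r) / 2) + Real.negMulLog ((1 - r) / 2)

lemma trace_mul_self {ρ : Matrix (Fin 2) (Fin 2) ℂ} (h : ρ.IsHermitian) (ht : ρ.trace = 1) :
    (ρ * ρ).trace = (((1 + bloch ρ ^ 2) / 2 : ℝ) : ℂ) := by
  obtain ⟨h0, h1, h01, htr⟩ := entries_of_isHermitian_of_trace_eq_one h ht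
  have hn : star (ρ 1 0) * ρ 1 0 = (Complex.normSq (ρ 1 0) : ℂ) :=
    Complex.normSq_eq_conj_mul_self.symm
  rw [bloch_sq, Matrix.trace_fin_two, Matrix.mul_apply, Matrix.mul_apply, Fin.sum_univ_two,
    Fin.sum_univ_two, h01, mul_comm (ρ 1 0), hn, h0, h1]
  have e : (ρ 0 0).re = 1 - (ρ 1 1).re := by linarith
  rw [e]
  push_cast
  simp
  ring

lemma entropy_eq {ρ : Matrix (Fin 2) (Fin 2) ℂ} (h : ρ.IsHermitian) (ht : ρ.trace = 1) :
    entropy ρ = (blochEntropy (bloch ρ) : ℂ) := by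
  rw [entropy, logm_eq h ht, mul_add, Matrix.trace_add, mul_smul_comm, mul_smul_comm, mul_one,
    Matrix.trace_smul, Matrix.trace_smul, ht, trace_mul_self h ht]
  have := logConst_add (bloch ρ)
  rw [blochEntropy, Real.negMulLog, Real.negMulLog, ← this]
  have h2 : Real.log ((1 + bloch ρ) / 2) =
    logConst (bloch ρ) + logSlope (bloch ρ) * ((1 + bloch ρ) / 2) := by simp [logConst]
  rw [h2, smul_eq_mul, smul_eq_mul]
  push_cast
  ring

lemma hasDerivAt_blochEntropy {r : ℝ} (h0 : -1 < r) (h1 : r < 1) :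
    HasDerivAt blochEntropy (-(r * logSlope r) / 2) r := by
  have ha : HasDerivAt (fun r : ℝ => (1 + r) / 2) (1 / 2) r :=
    ((hasDerivAt_id r).const_add 1).div_const 2
  have hb : HasDerivAt (fun r : ℝ => (1 - r) / 2) (-1 / 2) r :=
    ((hasDerivAt_id r).const_sub 1).div_const 2
  have := ((Real.hasDerivAt_negMulLog (x := (1 + r) / 2) (by linarith)).comp r ha).add
    ((Real.hasDerivAt_negMulLog (x := (1 - r) / 2) (by linarith)).comp r hb)
  refine this.congr_deriv ?_
  by_cases h : r = 0
  · subst h; simp; ring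
  · unfold logSlope; field_simp; ring

lemma bloch_lt_one {ρ : Matrix (Fin 2) (Fin 2) ℂ} (h : ρ.PosDef) (ht : ρ.trace = 1) :
    bloch ρ < 1 := by
  obtain ⟨h0, h1, h01, htr⟩ := entries_of_isHermitian_of_trace_eq_one h.1 ht
  have hd := h.det_pos
  have hn : star (ρ 1 0) * ρ 1 0 = (Complex.normSq (ρ 1 0) : ℂ) :=
    Complex.normSq_eq_conj_mul_self.symm
  rw [Matrix.det_fin_two, h01, hn, h0, h1] at hd
  have hd' : 0 < (ρ 0 0).re * (ρ 1 1).re - Complex.normSq (ρ 1 0) := by exact_mod_cast hd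
  have hb := bloch_sq ρ
  have hbn := bloch_nonneg ρ
  have e : (ρ 0 0).re = 1 - (ρ 1 1).re := by linarith
  rw [e] at hd' hb
  nlinarith

/-- `Ṡ = -Tr[ρ̇ ln ρ]`. At a maximally mixed `ρ(t)` the eigenvalues need not be differentiable, but
the entropy is even in the Bloch length, which is `O(|s - t|)`, so that both sides vanish. -/
lemma hasDerivAt_entropy {ρ : ℝ → Matrix (Fin 2) (Fin 2) ℂ} (h : ∀ s, (ρ s).IsHermitian)
    (ht : ∀ s, (ρ s).trace = 1) (hd : ∀ s i j, DifferentiableAt ℝ (fun s => ρ s i j) s) {t : ℝ}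
    (hpos : (ρ t).PosDef) :
    HasDerivAt (fun s => entropy (ρ s)) (-(rate ρ t * logm (ρ t)).trace) t := by
  have hS : (fun s => entropy (ρ s)) = fun s => ((blochEntropy (bloch (ρ s)) : ℝ) : ℂ) :=
    funext fun s => entropy_eq (h s) (ht s)
  have hD : ∀ i j, HasDerivAt (fun s => ρ s i j) (rate ρ t i j) t := fun i j =>
    (hd t i j).hasDerivAt
  have htr : (rate ρ t).trace = 0 := by
    have h1 : HasDerivAt (fun s => (ρ s).trace) (rate ρ t).trace t := by
      simp only [Matrix.trace_fin_two]
      exact (hD 0 0).add (hD 1 1)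
    simp only [ht] at h1
    exact h1.unique (hasDerivAt_const t 1)
  -- `d/dt Tr ρ² = 2 Tr[ρ̇ρ]`, and `Tr ρ² = (1 + r²)/2`.
  have hr2 : HasDerivAt (fun s => (((1 + bloch (ρ s) ^ 2) / 2 : ℝ) : ℂ))
      (2 * (rate ρ t * ρ t).trace) t := by
    have h1 : HasDerivAt (fun s => (ρ s * ρ s).trace) (2 * (rate ρ t * ρ t).trace) t := by
      simp only [Matrix.trace_fin_two, Matrix.mul_apply, Fin.sum_univ_two]
      refine ((((hD 0 0).mul (hD 0 0)).add ((hD 0 1).mul (hD 1 0))).add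
        (((hD 1 0).mul (hD 0 1)).add ((hD 1 1).mul (hD 1 1)))).congr_deriv ?_
      ring
    simpa only [trace_mul_self (h _) (ht _)] using h1
  have hre : HasDerivAt (fun s => bloch (ρ s) ^ 2) (4 * ((rate ρ t * ρ t).trace).re) t := by
    have h1 : HasDerivAt (fun s => (1 + bloch (ρ s) ^ 2) / 2)
        ((2 * (rate ρ t * ρ t).trace).re) t := by
      have h3 := Complex.reCLM.hasFDerivAt.comp_hasDerivAt t hr2
      simpa [Function.comp_def, ← Complex.ofReal_pow] using h3
    have h2 := (h1.const_mul 2).sub_const 1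
    refine (h2.congr_deriv ?_).congr_of_eventuallyEq (Filter.Eventually.of_forall fun s => ?_)
    · simp; ring
    · simp; ring
  have him : ((rate ρ t * ρ t).trace).im = 0 := by
    have h3 := Complex.imCLM.hasFDerivAt.comp_hasDerivAt t hr2
    have h4 : HasDerivAt (fun _ : ℝ => (0 : ℝ)) ((2 * (rate ρ t * ρ t).trace).im) t := by
      simpa [Function.comp_def, ← Complex.ofReal_pow] using h3
    have := h4.unique (hasDerivAt_const t 0)
    simpa using this
  have hval : -(rate ρ t * logm (ρ t)).trace =
      ((-(logSlope (bloch (ρ t)) * ((rate ρ t * ρ t).trace).re) : ℝ) : ℂ) := by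
    rw [logm_eq (h t) (ht t), mul_add, Matrix.trace_add, mul_smul_comm, mul_smul_comm, mul_one,
      Matrix.trace_smul, Matrix.trace_smul, htr]
    apply Complex.ext <;> simp [him]
  rw [hS, hval]
  refine HasDerivAt.ofReal_comp ?_
  have hlt := bloch_lt_one hpos (ht t)
  have hE := hasDerivAt_blochEntropy (by linarith [bloch_nonneg (ρ t)]) hlt
  by_cases h0 : bloch (ρ t) = 0
  · -- Differentiability of `r²` only bounds `r` by `O(√|s - t|)`; the entries give `O(s - t)`.
    rw [h0] at hE ⊢
    have hz : logSlope 0 = 0 := by simp [logSlope]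
    simp only [hz, mul_zero, zero_mul, neg_zero, zero_div] at hE ⊢
    have hO : (fun s => bloch (ρ s)) =O[nhds t] fun s => s - t := by
      have e0 := bloch_sq (ρ t)
      rw [h0] at e0
      have hn := Complex.normSq_nonneg (ρ t 1 0)
      have e1 : (ρ t 1 1).re - (ρ t 0 0).re = 0 := by nlinarith
      have e2 : ρ t 1 0 = 0 := Complex.normSq_eq_zero.1 (by nlinarith)
      have c1 := Complex.reCLM.hasFDerivAt.comp_hasDerivAt t ((hD 1 1).sub (hD 0 0))
      have o1 := c1.differentiableAt.isBigO_sub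
      have o2 := (hD 1 0).differentiableAt.isBigO_sub
      simp only [Function.comp_apply, Complex.reCLM_apply, Pi.sub_apply, Complex.sub_re, e1,
        sub_zero] at o1
      simp only [e2, sub_zero] at o2
      refine Asymptotics.IsBigO.trans ?_ (o1.norm_left.add (o2.norm_left.const_mul_left 2))
      refine Asymptotics.IsBigO.of_bound 1 (Filter.Eventually.of_forall fun s => ?_)
      rw [one_mul, Real.norm_of_nonneg (bloch_nonneg _), Real.norm_of_nonneg (by positivity)]
      refine abs_le_of_sq_le_sq' ?_ (by positivity) |>.2
      rw [bloch_sq, Complex.normSq_eq_norm_sq, Real.norm_eq_abs]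
      nlinarith [sq_abs ((ρ s 1 1).re - (ρ s 0 0).re), abs_nonneg ((ρ s 1 1).re - (ρ s 0 0).re),
        norm_nonneg (ρ s 1 0),
        mul_nonneg (abs_nonneg ((ρ s 1 1).re - (ρ s 0 0).re)) (norm_nonneg (ρ s 1 0))]
    have ht0 : Filter.Tendsto (fun s => bloch (ρ s)) (nhds t) (nhds 0) := by
      refine hO.trans_tendsto ?_
      have : Filter.Tendsto (fun s : ℝ => s - t) (nhds t) (nhds (t - t)) :=
        (continuous_id.sub continuous_const).tendsto t
      simpa using this
    rw [hasDerivAt_iff_isLittleO] at hE ⊢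
    simp only [smul_zero, sub_zero, h0] at hE ⊢
    exact (hE.comp_tendsto ht0).trans_isBigO hO
  · have hr : HasDerivAt (fun s => bloch (ρ s))
        (4 * ((rate ρ t * ρ t).trace).re / (2 * bloch (ρ t))) t := by
      have h1 := hre.sqrt (by positivity)
      simp only [Real.sqrt_sq (bloch_nonneg _)] at h1
      exact h1
    refine (hE.comp t hr).congr_deriv ?_
    field_simp
    ring
namespace Params

variable (P : Params)

/-! ### Occupation probabilities -/

/-- The Boltzmann factor `q = e^{-ω_B β_B}`. -/
def boltz : ℝ := Real.exp (-(P.ωB * P.βB))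

lemma boltz_pos : 0 < P.boltz := Real.exp_pos _

lemma exp_eq_boltz_pow (n : ℕ) : Real.exp (-(n * P.βB * P.ωB)) = P.boltz ^ n := by
  rw [boltz, ← Real.exp_nat_mul]
  congr 1
  ring

section thermal
variable {P} (hωB : 0 < P.ωB) (hβB : 0 < P.βB)
include hωB hβB

lemma boltz_lt_one : P.boltz < 1 := Real.exp_lt_one_iff.2 (by nlinarith [mul_pos hωB hβB])

lemma hasSum_boltz_pow : HasSum (fun n : ℕ => P.boltz ^ n) (1 - P.boltz)⁻¹ :=
  hasSum_geometric_of_lt_one P.boltz_pos.le (boltz_lt_one hωB hβB)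

lemma Z_eq : P.Z = (1 - P.boltz)⁻¹ := by
  simp only [Z, exp_eq_boltz_pow]
  exact (hasSum_boltz_pow hωB hβB).tsum_eq

lemma p_eq (n : ℕ) : P.p n = (1 - P.boltz) * P.boltz ^ n := by
  rw [p, exp_eq_boltz_pow, Z_eq hωB hβB, div_inv_eq_mul, mul_comm]

lemma p_nonneg (n : ℕ) : 0 ≤ P.p n := by
  rw [p_eq hωB hβB]
  have := boltz_lt_one hωB hβB
  have := P.boltz_pos
  exact mul_nonneg (by linarith) (by positivity)

lemma p_succ (n : ℕ) : P.p (n + 1) = P.boltz * P.p n := by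
  rw [p_eq hωB hβB, p_eq hωB hβB, pow_succ]
  ring

lemma hasSum_p : HasSum P.p 1 := by
  have h := (hasSum_boltz_pow hωB hβB).mul_left (1 - P.boltz)
  rw [mul_inv_cancel₀ (by linarith [boltz_lt_one hωB hβB])] at h
  rw [show P.p = _ from funext (p_eq hωB hβB)]
  exact h

lemma summable_pow_mul_p (k : ℕ) : Summable fun n : ℕ => ((n : ℝ) + 1) ^ k * P.p n := by
  have hq : ‖P.boltz‖ < 1 := by
    rw [Real.norm_of_nonneg P.boltz_pos.le]; exact boltz_lt_one hωB hβB
  have h : Summable fun n : ℕ => ((n + 1 : ℕ) : ℝ) ^ k * P.boltz ^ (n + 1) :=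
    (summable_nat_add_iff (f := fun n : ℕ => (n : ℝ) ^ k * P.boltz ^ n) 1).2
      (summable_pow_mul_geometric_of_norm_lt_one k hq)
  refine (h.mul_left ((1 - P.boltz) / P.boltz)).congr fun n => ?_
  have hb := P.boltz_pos.ne'
  rw [p_eq hωB hβB, pow_succ, Nat.cast_add_one]
  generalize ((n : ℝ) + 1) ^ k = a
  field_simp

end thermal

/-! ### Survival probabilities and amplitudes -/

lemma ratio_sq_le_one (n : ℕ) : P.Δ ^ 2 / P.Ω n ^ 2 ≤ 1 := by
  refine div_le_one_of_le₀ ?_ (sq_nonneg _)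
  rw [Ω_sq]
  have : 0 ≤ 4 * P.g ^ 2 * n := by positivity
  linarith

lemma abs_ratio_le_one (n : ℕ) : |P.Δ / P.Ω n| ≤ 1 := by
  rw [← sq_le_one_iff_abs_le_one, div_pow]
  exact P.ratio_sq_le_one n

lemma Ω_le (n : ℕ) : P.Ω n ≤ (|P.Δ| + 2 * |P.g|) * (n + 1) := by
  refine Real.sqrt_le_iff.2 ⟨by positivity, ?_⟩
  have hn : (0 : ℝ) ≤ n := n.cast_nonneg
  have h1 : P.Δ ^ 2 + 4 * P.g ^ 2 ≤ (|P.Δ| + 2 * |P.g|) ^ 2 := by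
    nlinarith [sq_abs P.Δ, sq_abs P.g, mul_nonneg (abs_nonneg P.Δ) (abs_nonneg P.g)]
  calc P.Δ ^ 2 + 4 * P.g ^ 2 * n ≤ (P.Δ ^ 2 + 4 * P.g ^ 2) * (n + 1) ^ 2 := by
        nlinarith [sq_nonneg P.Δ, sq_nonneg P.g, mul_nonneg (sq_nonneg P.Δ) hn,
          mul_nonneg (sq_nonneg P.g) hn, mul_nonneg (sq_nonneg P.Δ) (mul_nonneg hn hn),
          mul_nonneg (sq_nonneg P.g) (mul_nonneg hn hn)]
    _ ≤ _ := by rw [mul_pow]; gcongr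

lemma one_sub_surv (n : ℕ) (t : ℝ) : 1 - P.surv n t =
    (2 * (P.g * Real.sqrt n) / P.Ω n * Real.sin (P.Ω n * t / 2)) ^ 2 := by
  unfold surv
  by_cases h : P.Ω n = 0
  · simp [h]
  · have h1 := Real.sin_sq_add_cos_sq (P.Ω n * t / 2)
    have h2 := P.Ω_sq n
    have h3 : Real.sqrt n ^ 2 = n := Real.sq_sqrt (by positivity)
    have h4 : (2 * (P.g * Real.sqrt n) / P.Ω n) ^ 2 = 1 - P.Δ ^ 2 / P.Ω n ^ 2 := by
      field_simp
      rw [h3, h2]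
      ring
    rw [mul_pow, h4]
    linear_combination -h1

lemma surv_zero (t : ℝ) : P.surv 0 t = 1 := by
  have := P.one_sub_surv 0 t
  simp at this
  linarith

lemma surv_nonneg (n : ℕ) (t : ℝ) : 0 ≤ P.surv n t := by unfold surv; positivity

lemma surv_le_one (n : ℕ) (t : ℝ) : P.surv n t ≤ 1 := by
  have := P.one_sub_surv n t
  nlinarith [sq_nonneg (2 * (P.g * Real.sqrt n) / P.Ω n * Real.sin (P.Ω n * t / 2))]

lemma normSq_amp (n : ℕ) (t : ℝ) : Complex.normSq (P.amp n t) = P.surv n t := by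
  rw [amp, surv, Complex.normSq_apply]
  simp only [Complex.sub_re, Complex.sub_im, Complex.ofReal_re, Complex.ofReal_im, Complex.mul_re,
    Complex.mul_im, Complex.I_re, Complex.I_im]
  ring

lemma norm_amp_le_one (n : ℕ) (t : ℝ) : ‖P.amp n t‖ ≤ 1 := by
  have h := P.surv_le_one n t
  rw [← normSq_amp, Complex.normSq_eq_norm_sq] at h
  exact (sq_le_one_iff₀ (norm_nonneg _)).1 h

/-- The time derivative of `surv`. -/
def survDeriv (n : ℕ) (t : ℝ) : ℝ :=
  -((1 - P.Δ ^ 2 / P.Ω n ^ 2) * P.Ω n * (Real.sin (P.Ω n * t / 2) * Real.cos (P.Ω n * t / 2)))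

/-- The time derivative of `amp`. -/
def ampDeriv (n : ℕ) (t : ℝ) : ℂ :=
  ((-(Real.sin (P.Ω n * t / 2) * (P.Ω n / 2)) : ℝ) : ℂ) -
    Complex.I * ((P.Δ / P.Ω n * (Real.cos (P.Ω n * t / 2) * (P.Ω n / 2)) : ℝ) : ℂ)

lemma hasDerivAt_angle (n : ℕ) (t : ℝ) : HasDerivAt (fun s => P.Ω n * s / 2) (P.Ω n / 2) t := by
  simpa using ((hasDerivAt_id t).const_mul (P.Ω n)).div_const 2

lemma hasDerivAt_surv (n : ℕ) (t : ℝ) : HasDerivAt (P.surv n) (P.survDeriv n t) t := by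
  have hc := (P.hasDerivAt_angle n t).cos.pow 2
  have hs := ((P.hasDerivAt_angle n t).sin.pow 2).const_mul (P.Δ ^ 2 / P.Ω n ^ 2)
  refine (hc.add hs).congr_deriv ?_
  unfold survDeriv
  push_cast
  ring

lemma hasDerivAt_amp (n : ℕ) (t : ℝ) : HasDerivAt (P.amp n) (P.ampDeriv n t) t := by
  have hc := (P.hasDerivAt_angle n t).cos.ofReal_comp
  have hs := ((P.hasDerivAt_angle n t).sin.const_mul (P.Δ / P.Ω n)).ofReal_comp
  refine (hc.sub (hs.const_mul Complex.I)).congr_deriv ?_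
  simp [ampDeriv]

lemma abs_survDeriv_le (n : ℕ) (t : ℝ) :
    |P.survDeriv n t| ≤ (|P.Δ| + 2 * |P.g|) * (n + 1) := by
  refine le_trans ?_ (P.Ω_le n)
  have h0 : 0 ≤ 1 - P.Δ ^ 2 / P.Ω n ^ 2 := by linarith [P.ratio_sq_le_one n]
  have h1 : 1 - P.Δ ^ 2 / P.Ω n ^ 2 ≤ 1 := by
    have : 0 ≤ P.Δ ^ 2 / P.Ω n ^ 2 := by positivity
    linarith
  have h2 := P.Ω_nonneg n
  rw [survDeriv, abs_neg, abs_mul, abs_mul, abs_mul, abs_of_nonneg h0, abs_of_nonneg h2]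
  calc _ ≤ 1 * P.Ω n * (1 * 1) := by
        gcongr
        · exact Real.abs_sin_le_one _
        · exact Real.abs_cos_le_one _
    _ = _ := by ring

lemma norm_ampDeriv_le (n : ℕ) (t : ℝ) :
    ‖P.ampDeriv n t‖ ≤ (|P.Δ| + 2 * |P.g|) * (n + 1) := by
  refine le_trans ?_ (P.Ω_le n)
  have h2 := P.Ω_nonneg n
  have h3 : |P.Ω n / 2| = P.Ω n / 2 := abs_of_nonneg (by positivity)
  refine (norm_sub_le _ _).trans ?_
  rw [norm_mul, Complex.norm_I, one_mul, Complex.norm_real, Complex.norm_real, Real.norm_eq_abs,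
    Real.norm_eq_abs, abs_neg, abs_mul, abs_mul, abs_mul, h3]
  calc _ ≤ 1 * (P.Ω n / 2) + 1 * (1 * (P.Ω n / 2)) := by
        gcongr
        · exact Real.abs_sin_le_one _
        · exact P.abs_ratio_le_one n
        · exact Real.abs_cos_le_one _
    _ = _ := by ring

/-! ### The series `α`, `β`, `γ` -/

/-- The `n`-th term of the series of `γ`. -/
def γTerm (n : ℕ) (t : ℝ) : ℂ :=
  (P.p n : ℂ) * Complex.exp (-(Complex.I * P.ωB * t)) * P.amp n t * P.amp (n + 1) t

/-- The time derivative of `γTerm`. -/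
def γTermDeriv (n : ℕ) (t : ℝ) : ℂ :=
  (P.p n : ℂ) * Complex.exp (-(Complex.I * P.ωB * t)) * (-(Complex.I * P.ωB)
    * P.amp n t * P.amp (n + 1) t + P.ampDeriv n t * P.amp (n + 1) t
    + P.amp n t * P.ampDeriv (n + 1) t)

lemma hasDerivAt_γTerm (n : ℕ) (t : ℝ) : HasDerivAt (P.γTerm n) (P.γTermDeriv n t) t := by
  have h1 : HasDerivAt (fun s : ℝ => -(Complex.I * P.ωB * (s : ℂ))) (-(Complex.I * P.ωB)) t := by
    have h := ((Complex.ofRealCLM.hasDerivAt (x := t)).const_mul (Complex.I * P.ωB)).neg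
    rw [Complex.ofRealCLM_apply, Complex.ofReal_one, mul_one] at h
    exact h
  have h2 := (((h1.cexp).const_mul (P.p n : ℂ)).mul (P.hasDerivAt_amp n t)).mul
    (P.hasDerivAt_amp (n + 1) t)
  refine h2.congr_deriv ?_
  unfold γTermDeriv
  simp only [Pi.mul_apply]
  ring

lemma norm_phase_ωB (t : ℝ) : ‖Complex.exp (-(Complex.I * P.ωB * t))‖ = 1 := by
  rw [Complex.norm_exp]
  simp

/-- The excitation probability which the `n`-th block exchanges between qubit and mode, weighted
with `p_n`. -/
def exch (n : ℕ) (t : ℝ) : ℝ := P.p n * (1 - P.surv n t)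

/-- The time derivative of `exch`. -/
def exchDeriv (n : ℕ) (t : ℝ) : ℝ := -(P.p n * P.survDeriv n t)

lemma exch_zero (t : ℝ) : P.exch 0 t = 0 := by simp [exch, surv_zero]

lemma exchDeriv_zero (t : ℝ) : P.exchDeriv 0 t = 0 := by
  by_cases h : P.Δ = 0
  · simp [exchDeriv, survDeriv, Ω, h]
  · simp [exchDeriv, survDeriv, P.Ω_sq 0, h]

lemma hasDerivAt_exch (n : ℕ) (t : ℝ) : HasDerivAt (P.exch n) (P.exchDeriv n t) t := by
  refine (((P.hasDerivAt_surv n t).const_sub 1).const_mul (P.p n)).congr_deriv ?_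
  simp [exchDeriv]

section thermal
variable {P} (hωB : 0 < P.ωB) (hβB : 0 < P.βB)
include hωB hβB

lemma summable_weighted {f : ℕ → ℝ} {C : ℝ} (k : ℕ) (hf : ∀ n, |f n| ≤ C * (n + 1)) :
    Summable fun n : ℕ => (n : ℝ) ^ k * (P.p n * f n) := by
  refine Summable.of_norm_bounded ((summable_pow_mul_p hωB hβB (k + 1)).mul_left C) fun n => ?_
  have hp := p_nonneg hωB hβB n
  rw [Real.norm_eq_abs, abs_mul, abs_mul, abs_of_nonneg hp, abs_of_nonneg (by positivity)]
  calc (n : ℝ) ^ k * (P.p n * |f n|) ≤ (n + 1 : ℝ) ^ k * (P.p n * (C * (n + 1))) := by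
        gcongr
        · linarith
        · exact hf n
    _ = _ := by ring

lemma summable_exch (k : ℕ) (t : ℝ) : Summable fun n : ℕ => (n : ℝ) ^ k * P.exch n t := by
  refine summable_weighted hωB hβB (C := 1) k fun n => ?_
  have h1 := P.surv_nonneg n t
  have h2 := P.surv_le_one n t
  have : (0 : ℝ) ≤ n := n.cast_nonneg
  rw [abs_le]
  constructor <;> linarith

lemma summable_exchDeriv (k : ℕ) (t : ℝ) :
    Summable fun n : ℕ => (n : ℝ) ^ k * P.exchDeriv n t := by
  have := (summable_weighted hωB hβB k fun n => P.abs_survDeriv_le n t).neg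
  refine this.congr fun n => ?_
  rw [exchDeriv]; ring

lemma hasSum_exch (t : ℝ) : HasSum (fun n => P.exch n t) (1 - P.α t) := by
  have h : Summable fun n => P.exch n t := by simpa using summable_exch hωB hβB 0 t
  have h1 : HasSum (fun n => P.p n * P.surv n t) (1 - ∑' n, P.exch n t) := by
    refine ((hasSum_p hωB hβB).sub h.hasSum).congr_fun ?_
    intro n; simp only [exch]; ring
  have h2 : 1 - P.α t = ∑' n, P.exch n t := by rw [α, h1.tsum_eq]; ring
  rw [h2]
  exact h.hasSum

lemma hasDerivAt_α (t : ℝ) : HasDerivAt P.α (-∑' n, P.exchDeriv n t) t := by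
  have hα : P.α = fun s => 1 - ∑' n, P.exch n s := by
    funext s
    rw [(hasSum_exch hωB hβB s).tsum_eq]; ring
  rw [hα]
  refine (hasDerivAt_tsum ((summable_pow_mul_p hωB hβB 1).mul_left (|P.Δ| + 2 * |P.g|))
    P.hasDerivAt_exch (fun n s => ?_) (y₀ := t) ?_ t).const_sub 1
  · have hp := p_nonneg hωB hβB n
    rw [exchDeriv, norm_neg, Real.norm_eq_abs, abs_mul, abs_of_nonneg hp]
    calc _ ≤ P.p n * ((|P.Δ| + 2 * |P.g|) * (n + 1)) := by
          gcongr
          exact P.abs_survDeriv_le n s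
      _ = _ := by ring
  · exact (hasSum_exch hωB hβB t).summable

/-- `α` and `β` are related because `p_{n+1} = q p_n` and the ground state `|0,0⟩` is stationary.
This is detailed balance for the exchange of an excitation. -/
lemma α_eq (t : ℝ) : P.α t = 1 - P.boltz + P.boltz * P.β t := by
  have hs : Summable fun n => P.p n * P.surv n t := by
    refine ((hasSum_p hωB hβB).summable.sub (hasSum_exch hωB hβB t).summable).congr fun n => ?_
    rw [exch]; ring
  rw [α, hs.tsum_eq_zero_add, β, ← tsum_mul_left, surv_zero, p_eq hωB hβB, pow_zero]
  simp only [p_succ hωB hβB, mul_assoc, mul_one]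

lemma β_eq (t : ℝ) : P.β t = 1 - (1 - P.α t) / P.boltz := by
  have := P.boltz_pos
  rw [α_eq hωB hβB]
  field_simp
  ring

lemma deriv_α (t : ℝ) : deriv P.α t = -∑' n, P.exchDeriv n t := (hasDerivAt_α hωB hβB t).deriv

lemma hasDerivAt_β (t : ℝ) : HasDerivAt P.β (deriv P.α t / P.boltz) t := by
  have h := (((hasDerivAt_α hωB hβB t).const_sub 1).div_const P.boltz).const_sub 1
  rw [show P.β = _ from funext (β_eq hωB hβB), deriv_α hωB hβB]
  refine h.congr_deriv ?_
  ring

lemma hasSum_γTerm (t : ℝ) : HasSum (fun n => P.γTerm n t) (P.γ t) := by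
  refine Summable.hasSum (Summable.of_norm_bounded (hasSum_p hωB hβB).summable fun n => ?_)
  have hp := p_nonneg hωB hβB n
  rw [γTerm, norm_mul, norm_mul, norm_mul, norm_phase_ωB, Complex.norm_real,
    Real.norm_of_nonneg hp]
  calc _ ≤ P.p n * 1 * 1 * 1 := by gcongr <;> exact P.norm_amp_le_one _ _
    _ = _ := by ring

lemma differentiable_γ : Differentiable ℝ P.γ := by
  have hsum : P.γ = fun s => ∑' n, P.γTerm n s := rfl
  rw [hsum]
  intro t
  refine (hasDerivAt_tsum ((summable_pow_mul_p hωB hβB 1).mul_left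
    (P.ωB + 3 * (|P.Δ| + 2 * |P.g|)))
    P.hasDerivAt_γTerm (fun n s => ?_) (y₀ := t) ?_ t).differentiableAt
  · have hp := p_nonneg hωB hβB n
    have hn : (0 : ℝ) ≤ n := n.cast_nonneg
    set K := |P.Δ| + 2 * |P.g| with hK
    have hK0 : 0 ≤ K := by positivity
    rw [γTermDeriv, norm_mul, norm_mul, norm_phase_ωB, Complex.norm_real,
      Real.norm_of_nonneg hp, mul_one]
    have h1 : ‖-(Complex.I * P.ωB) * P.amp n s * P.amp (n + 1) s‖ ≤ P.ωB * 1 * 1 := by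
      rw [norm_mul, norm_mul, norm_neg, norm_mul, Complex.norm_I, one_mul, Complex.norm_real,
        Real.norm_of_nonneg hωB.le]
      gcongr <;> exact P.norm_amp_le_one _ _
    have h2 : ‖P.ampDeriv n s * P.amp (n + 1) s‖ ≤ K * (n + 1) * 1 := by
      rw [norm_mul]
      gcongr
      · exact P.norm_ampDeriv_le n s
      · exact P.norm_amp_le_one _ _
    have h3 : ‖P.amp n s * P.ampDeriv (n + 1) s‖ ≤ 1 * (K * ((n + 1 : ℕ) + 1)) := by
      rw [norm_mul]
      gcongr
      · exact P.norm_amp_le_one _ _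
      · exact P.norm_ampDeriv_le (n + 1) s
    push_cast at h3
    have h4 := norm_add₃_le (a := -(Complex.I * P.ωB) * P.amp n s * P.amp (n + 1) s)
      (b := P.ampDeriv n s * P.amp (n + 1) s) (c := P.amp n s * P.ampDeriv (n + 1) s)
    calc _ ≤ P.p n * ((P.ωB + 3 * K) * (n + 1)) := by
          gcongr
          nlinarith [mul_nonneg hK0 hn, mul_nonneg hωB.le hn]
      _ = _ := by ring
  · exact (hasSum_γTerm hωB hβB t).summable

end thermal
/-! ### The evolved states -/

lemma normSq_phase (n : ℕ) (t : ℝ) : Complex.normSq (P.phase n t) = 1 := by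
  rw [Complex.normSq_eq_norm_sq, phase, Complex.norm_exp]
  simp

lemma normSq_hop (n : ℕ) (t : ℝ) : Complex.normSq (P.hop n t) = 1 - P.surv n t := by
  rw [one_sub_surv, hop, Complex.normSq_neg, Complex.normSq_mul, Complex.normSq_I, one_mul,
    Complex.normSq_ofReal, sq]

/-- Consecutive blocks are detuned by `ω_B`. -/
lemma phase_succ (n : ℕ) (t : ℝ) : P.phase (n + 1) t * star (P.phase n t) =
    Complex.exp (-(Complex.I * P.ωB * t)) := by
  rw [phase, phase, Complex.star_def, ← Complex.exp_conj, ← Complex.exp_add]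
  congr 1
  simp only [map_mul, map_neg, map_add, map_div₀, Complex.conj_I, Complex.conj_ofReal, map_natCast,
    map_ofNat]
  push_cast
  ring

/-- The weighted difference of the initial populations which drives the exchange of excitations. -/
def imbalance (ρ₀ : Matrix (Fin 2) (Fin 2) ℂ) : ℂ := ρ₀ 0 0 - ρ₀ 1 1 / P.boltz

lemma hasSum_opExp_HB (i j : ℕ) : HasSum (opExpTerm (-(P.βB : ℂ) • P.HB) i j)
    (Matrix.diagonal (fun n : ℕ => ((P.boltz ^ n : ℝ) : ℂ)) i j) := by
  have h : -(P.βB : ℂ) • P.HB = Matrix.diagonal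
      (fun n : ℕ => ((-(n * P.βB * P.ωB) : ℝ) : ℂ)) := by
    rw [HB_eq, ← Matrix.diagonal_smul]
    congr 1
    funext n
    simp
    ring
  rw [h]
  have := hasSum_opExpTerm_diagonal (fun n : ℕ => ((-(n * P.βB * P.ωB) : ℝ) : ℂ)) i j
  simpa only [← Complex.ofReal_exp, exp_eq_boltz_pow] using this

lemma opExp_HB_eq : opExp (-(P.βB : ℂ) • P.HB) =
    Matrix.diagonal (fun n : ℕ => ((P.boltz ^ n : ℝ) : ℂ)) := by
  ext i j
  exact (P.hasSum_opExp_HB i j).tsum_eq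

lemma differentiable_phase (n : ℕ) : Differentiable ℝ (P.phase n) := by
  unfold phase
  have : Differentiable ℝ fun s : ℝ => (s : ℂ) := Complex.ofRealCLM.differentiable
  fun_prop

lemma differentiable_amp (n : ℕ) : Differentiable ℝ (P.amp n) :=
  fun t => (P.hasDerivAt_amp n t).differentiableAt

lemma differentiable_hop (n : ℕ) : Differentiable ℝ (P.hop n) := fun t =>
  (((P.hasDerivAt_angle n t).sin.const_mul _).ofReal_comp.const_mul
    Complex.I).neg.differentiableAt

lemma differentiable_evol (i j : Fin 2 × ℕ) : Differentiable ℝ (fun t => P.evol t i j) := by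
  obtain ⟨i, m⟩ := i
  obtain ⟨j, n⟩ := j
  fin_cases i <;> fin_cases j <;> simp only [evol, Fin.zero_eta, Fin.mk_one, ladder_zero_zero,
    ladder_one_one, ladder_zero_one, ladder_one_zero] <;> split_ifs
  · exact (P.differentiable_phase n).mul (P.differentiable_amp n).star
  · exact differentiable_const _
  · exact (P.differentiable_phase _).mul (P.differentiable_hop _)
  · exact differentiable_const _
  · exact (P.differentiable_phase _).mul (P.differentiable_hop _)
  · exact differentiable_const _
  · exact (P.differentiable_phase _).mul (P.differentiable_amp _)
  · exact differentiable_const _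

section thermal
variable {P} (hωB : 0 < P.ωB) (hβB : 0 < P.βB)
include hωB hβB

lemma thermalB_eq : thermalB P.HB P.βB = Matrix.diagonal (fun n : ℕ => (P.p n : ℂ)) := by
  have htr : opTrace (Matrix.diagonal (fun n : ℕ => ((P.boltz ^ n : ℝ) : ℂ))) =
      (((1 - P.boltz)⁻¹ : ℝ) : ℂ) := by
    unfold opTrace
    simp only [Matrix.diagonal_apply_eq]
    rw [← Complex.ofReal_tsum, (hasSum_boltz_pow hωB hβB).tsum_eq]
  rw [thermalB, opExp_HB_eq, htr, ← Matrix.diagonal_smul]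
  congr 1
  funext n
  rw [p_eq hωB hβB]
  simp

variable (ρ₀ : Matrix (Fin 2) (Fin 2) ℂ)

lemma ρAB_eq (t : ℝ) : P.ρAB ρ₀ t = opMul (Matrix.of fun i (j : Fin 2 × ℕ) =>
    (P.evol t i (0, j.2) * ρ₀ 0 j.1 + P.evol t i (1, j.2) * ρ₀ 1 j.1) * P.p j.2)
    (P.evol t)ᴴ := by
  rw [ρAB, U_eq, thermalB_eq hωB hβB]
  congr 1
  ext i ⟨j, n⟩
  rw [opMul_kronecker_diagonal]
  rfl

lemma differentiable_ρAB (i j : Fin 2 × ℕ) : Differentiable ℝ (fun t => P.ρAB ρ₀ t i j) := by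
  have hY : ∀ j : Fin 2 × ℕ, Differentiable ℝ fun t => (P.evol t i (0, j.2) * ρ₀ 0 j.1 +
      P.evol t i (1, j.2) * ρ₀ 1 j.1) * (P.p j.2 : ℂ) := fun j =>
    (((P.differentiable_evol _ _).mul_const _).add
      ((P.differentiable_evol _ _).mul_const _)).mul_const _
  have hx : ∀ n, Differentiable ℝ fun t => star (P.phase n t * star (P.amp n t)) := fun n =>
    ((P.differentiable_phase n).mul (P.differentiable_amp n).star).star
  have hy : ∀ n, Differentiable ℝ fun t => star (P.phase n t * P.amp n t) := fun n =>
    ((P.differentiable_phase n).mul (P.differentiable_amp n)).star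
  have hz : ∀ n, Differentiable ℝ fun t => star (P.phase n t * P.hop n t) := fun n =>
    ((P.differentiable_phase n).mul (P.differentiable_hop n)).star
  simp only [ρAB_eq hωB hβB]
  obtain ⟨j, n⟩ := j
  fin_cases j
  · rcases n with _ | n
    · simp only [Fin.zero_eta, evol, conjTranspose_ladder, opMul_ladder_zero_zero]
      exact (hY (0, 0)).mul (hx 0)
    · simp only [Fin.zero_eta, evol, conjTranspose_ladder, opMul_ladder_zero_succ]
      exact ((hY (0, n + 1)).mul (hx (n + 1))).add ((hY (1, n)).mul (hz (n + 1)))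
  · simp only [Fin.mk_one, evol, conjTranspose_ladder, opMul_ladder_one]
    exact ((hY (1, n)).mul (hy (n + 1))).add ((hY (0, n + 1)).mul (hz (n + 1)))

lemma ρAB_zero_zero (n : ℕ) (t : ℝ) : P.ρAB ρ₀ t (0, n) (0, n) =
    P.p n * ρ₀ 0 0 - P.imbalance ρ₀ * P.exch n t := by
  have hA : P.phase n t * star (P.phase n t) = 1 := by
    rw [Complex.star_def, Complex.mul_conj, normSq_phase]; simp
  have hB : P.amp n t * star (P.amp n t) = P.surv n t := by
    rw [Complex.star_def, Complex.mul_conj, normSq_amp]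
  have hC : P.hop n t * star (P.hop n t) = 1 - P.surv n t := by
    rw [Complex.star_def, Complex.mul_conj, normSq_hop]; simp
  rw [ρAB_eq hωB hβB, evol, conjTranspose_ladder]
  rcases n with _ | n
  · rw [opMul_ladder_zero_zero]
    simp only [Matrix.of_apply, ladder_zero_zero, ladder_zero_one, if_true, Pi.star_apply,
      exch_zero, star_mul', star_star]
    rw [surv_zero] at hB
    simp only [(Nat.succ_ne_zero 0).symm, if_false]
    linear_combination (norm := (push_cast; ring))
      ρ₀ 0 0 * P.p 0 * hB + ρ₀ 0 0 * P.p 0 * (P.amp 0 t * star (P.amp 0 t)) * hA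
  · rw [opMul_ladder_zero_succ]
    have hq : (P.boltz : ℂ) ≠ 0 := by exact_mod_cast P.boltz_pos.ne'
    simp only [Matrix.of_apply, ladder_zero_zero, ladder_zero_one, if_true, Pi.star_apply,
      star_mul', star_star, imbalance, exch, p_succ hωB hβB,
      show ¬ n + 1 = n by omega, show ¬ n + 1 = n + 1 + 1 by omega, if_false]
    push_cast
    field_simp
    linear_combination ρ₀ 0 0 * P.boltz * P.p n * hB + ρ₀ 1 1 * P.p n * hC +
      (ρ₀ 0 0 * P.boltz * P.p n * (P.amp (n + 1) t * star (P.amp (n + 1) t)) +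
      ρ₀ 1 1 * P.p n * (P.hop (n + 1) t * star (P.hop (n + 1) t))) * hA

lemma ρAB_one_one (n : ℕ) (t : ℝ) : P.ρAB ρ₀ t (1, n) (1, n) =
    P.p n * ρ₀ 1 1 + P.imbalance ρ₀ * P.exch (n + 1) t := by
  have hA : P.phase (n + 1) t * star (P.phase (n + 1) t) = 1 := by
    rw [Complex.star_def, Complex.mul_conj, normSq_phase]; simp
  have hB : P.amp (n + 1) t * star (P.amp (n + 1) t) = P.surv (n + 1) t := by
    rw [Complex.star_def, Complex.mul_conj, normSq_amp]
  have hC : P.hop (n + 1) t * star (P.hop (n + 1) t) = 1 - P.surv (n + 1) t := by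
    rw [Complex.star_def, Complex.mul_conj, normSq_hop]; simp
  have hq : (P.boltz : ℂ) ≠ 0 := by exact_mod_cast P.boltz_pos.ne'
  rw [ρAB_eq hωB hβB, evol, conjTranspose_ladder, opMul_ladder_one]
  simp only [Matrix.of_apply, ladder_one_zero, ladder_one_one, if_true, Pi.star_apply,
    star_mul', imbalance, exch, p_succ hωB hβB]
  rw [if_neg (by omega), if_neg (by omega)]
  push_cast
  field_simp
  linear_combination ρ₀ 1 1 * P.p n * hB + P.boltz * ρ₀ 0 0 * P.p n * hC +
      (ρ₀ 1 1 * P.p n * (P.amp (n + 1) t * star (P.amp (n + 1) t)) +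
      P.boltz * ρ₀ 0 0 * P.p n * (P.hop (n + 1) t * star (P.hop (n + 1) t))) * hA

lemma ρAB_one_zero (n : ℕ) (t : ℝ) : P.ρAB ρ₀ t (1, n) (0, n) = ρ₀ 1 0 * P.γTerm n t := by
  rw [ρAB_eq hωB hβB, evol, conjTranspose_ladder, γTerm, ← phase_succ P n]
  rcases n with _ | n
  · rw [opMul_ladder_zero_zero]
    simp
    ring
  · rw [opMul_ladder_zero_succ]
    simp [show ¬ n + 1 + 1 = n by omega]
    ring

lemma ρAB_zero_one (n : ℕ) (t : ℝ) :
    P.ρAB ρ₀ t (0, n) (1, n) = ρ₀ 0 1 * star (P.γTerm n t) := by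
  rw [ρAB_eq hωB hβB, evol, conjTranspose_ladder, γTerm, ← phase_succ P n, opMul_ladder_one]
  simp [show ¬ n = n + 1 + 1 by omega]
  ring

/-! ### The reduced state of the qubit -/

lemma hasSum_ρAB (t : ℝ) (i j : Fin 2) : HasSum (fun n => P.ρAB ρ₀ t (i, n) (j, n))
    (!![ρ₀ 0 0 - P.imbalance ρ₀ * ((1 - P.α t : ℝ) : ℂ), ρ₀ 0 1 * star (P.γ t);
        ρ₀ 1 0 * P.γ t, ρ₀ 1 1 + P.imbalance ρ₀ * ((1 - P.α t : ℝ) : ℂ)] i j) := by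
  have hp : HasSum (fun n => (P.p n : ℂ)) 1 := by
    simpa using Complex.hasSum_ofReal.2 (hasSum_p hωB hβB)
  have hD := hasSum_exch hωB hβB t
  fin_cases i <;> fin_cases j
  · simp only [Fin.zero_eta, ρAB_zero_zero hωB hβB]
    have h := (hp.mul_right (ρ₀ 0 0)).sub
      ((Complex.hasSum_ofReal.2 hD).mul_left (P.imbalance ρ₀))
    rw [one_mul] at h
    exact h
  · simp only [Fin.zero_eta, Fin.mk_one, ρAB_zero_one hωB hβB]
    exact ((hasSum_γTerm hωB hβB t).star).mul_left _
  · simp only [Fin.zero_eta, Fin.mk_one, ρAB_one_zero hωB hβB]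
    exact (hasSum_γTerm hωB hβB t).mul_left _
  · simp only [Fin.mk_one, ρAB_one_one hωB hβB]
    have hD' : HasSum (fun n => P.exch (n + 1) t) (1 - P.α t) := by
      refine (hasSum_nat_add_iff (f := fun n => P.exch n t) 1).2 ?_
      simpa [exch_zero] using hD
    have h := (hp.mul_right (ρ₀ 1 1)).add
      ((Complex.hasSum_ofReal.2 hD').mul_left (P.imbalance ρ₀))
    rw [one_mul] at h
    exact h

lemma ρA_eq (t : ℝ) : P.ρA ρ₀ t =
    !![ρ₀ 0 0 - P.imbalance ρ₀ * ((1 - P.α t : ℝ) : ℂ), ρ₀ 0 1 * star (P.γ t);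
        ρ₀ 1 0 * P.γ t, ρ₀ 1 1 + P.imbalance ρ₀ * ((1 - P.α t : ℝ) : ℂ)] := by
  ext i j
  exact (hasSum_ρAB hωB hβB ρ₀ t i j).tsum_eq

lemma hasDerivAt_ρA (t : ℝ) (i j : Fin 2) : HasDerivAt (fun s => P.ρA ρ₀ s i j)
    (!![P.imbalance ρ₀ * (deriv P.α t : ℝ), ρ₀ 0 1 * star (deriv P.γ t);
        ρ₀ 1 0 * deriv P.γ t, -(P.imbalance ρ₀ * (deriv P.α t : ℝ))] i j) t := by
  have hα := (((hasDerivAt_α hωB hβB t).differentiableAt.hasDerivAt.const_sub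
    1).ofReal_comp).const_mul (P.imbalance ρ₀)
  have hγ := (differentiable_γ hωB hβB t).hasDerivAt
  simp only [ρA_eq hωB hβB]
  fin_cases i <;> fin_cases j
  · refine (hα.const_sub (ρ₀ 0 0)).congr_deriv ?_
    simp
  · exact hγ.star.const_mul (ρ₀ 0 1)
  · exact hγ.const_mul (ρ₀ 1 0)
  · refine (hα.const_add (ρ₀ 1 1)).congr_deriv ?_
    simp

lemma rate_ρA (t : ℝ) : rate (P.ρA ρ₀) t =
    !![P.imbalance ρ₀ * (deriv P.α t : ℝ), ρ₀ 0 1 * star (deriv P.γ t);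
        ρ₀ 1 0 * deriv P.γ t, -(P.imbalance ρ₀ * (deriv P.α t : ℝ))] := by
  ext i j
  exact (hasDerivAt_ρA hωB hβB ρ₀ t i j).deriv

variable {ρ₀} (hρ₀ : IsState ρ₀)
include hρ₀

lemma trace_ρA (t : ℝ) : (P.ρA ρ₀ t).trace = 1 := by
  have h := hρ₀.2
  rw [Matrix.trace_fin_two] at h
  rw [ρA_eq hωB hβB, Matrix.trace_fin_two, ← h]
  simp

lemma isHermitian_ρA (t : ℝ) : (P.ρA ρ₀ t).IsHermitian := by
  obtain ⟨h0, h1, h01, -⟩ := entries_of_isHermitian_of_trace_eq_one hρ₀.1.1 hρ₀.2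
  have hi : star (P.imbalance ρ₀) = P.imbalance ρ₀ := by
    rw [imbalance, h0, h1]
    simp only [Complex.star_def, map_sub, map_div₀, Complex.conj_ofReal]
  rw [ρA_eq hωB hβB]
  refine Matrix.IsHermitian.ext fun i j => ?_
  fin_cases i <;> fin_cases j
  · simp only [Fin.zero_eta, Matrix.of_apply, Matrix.cons_val', Matrix.cons_val_zero, star_sub,
      star_mul', hi]
    rw [h0]
    simp only [Complex.star_def, Complex.conj_ofReal]
  · simp [h01]
  · simp [h01]
  · simp only [Fin.mk_one, Matrix.of_apply, Matrix.cons_val', Matrix.cons_val_one, star_add,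
      star_mul', hi, Matrix.cons_val_fin_one]
    rw [h1]
    simp only [Complex.star_def, Complex.conj_ofReal]

/-! ### The energy of the mode -/

lemma ρB_diag (n : ℕ) (t : ℝ) : P.ρB ρ₀ t n n =
    P.p n + P.imbalance ρ₀ * ((P.exch (n + 1) t - P.exch n t : ℝ) : ℂ) := by
  have h := hρ₀.2
  rw [Matrix.trace_fin_two] at h
  simp only [ρB, traceA, Matrix.of_apply, Fin.sum_univ_two]
  rw [ρAB_zero_zero hωB hβB, ρAB_one_one hωB hβB]
  push_cast
  linear_combination (P.p n : ℂ) * h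

omit hωB hβB hρ₀ in
/-- Summation by parts for an excitation flux `f` between neighbouring levels. -/
lemma hasSum_nat_mul_sub {f : ℕ → ℝ} {a : ℝ} (h0 : f 0 = 0) (hf : HasSum f a)
    (hn : Summable fun n : ℕ => (n : ℝ) * f n) :
    HasSum (fun n : ℕ => (n : ℝ) * (f (n + 1) - f n)) (-a) := by
  have h1 : HasSum (fun n => f (n + 1)) a := by
    refine (hasSum_nat_add_iff (f := f) 1).2 ?_
    simpa [h0] using hf
  have h2 : HasSum (fun n : ℕ => ((n + 1 : ℕ) : ℝ) * f (n + 1)) (∑' n : ℕ, (n : ℝ) * f n) := by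
    refine (hasSum_nat_add_iff (f := fun n : ℕ => (n : ℝ) * f n) 1).2 ?_
    simpa using hn.hasSum
  have h3 := (h2.sub h1).sub hn.hasSum
  rw [show (∑' n : ℕ, (n : ℝ) * f n) - a - ∑' n : ℕ, (n : ℝ) * f n = -a by ring] at h3
  refine h3.congr_fun fun n => ?_
  push_cast
  ring

omit hρ₀ in
lemma summable_nat_mul_p : Summable fun n : ℕ => (n : ℝ) * P.p n := by
  simpa using summable_weighted hωB hβB (f := fun _ => 1) (C := 1) 1 fun n => by simp

lemma hasSum_energy (t : ℝ) : HasSum (fun n => opMul (P.ρB ρ₀ t) P.HB n n)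
    (P.ωB * (((∑' n : ℕ, (n : ℝ) * P.p n : ℝ) : ℂ) - P.imbalance ρ₀ * ((1 - P.α t : ℝ) : ℂ))) := by
  have h1 := hasSum_nat_mul_sub (P.exch_zero t) (hasSum_exch hωB hβB t)
    (by simpa using summable_exch hωB hβB 1 t)
  have h2 := ((Complex.hasSum_ofReal.2 (summable_nat_mul_p hωB hβB).hasSum).add
    ((Complex.hasSum_ofReal.2 h1).mul_left (P.imbalance ρ₀))).mul_left (P.ωB : ℂ)
  refine hasSum_of_eq h2 (fun n => ?_) ?_
  · rw [HB_eq, opMul_diagonal, ρB_diag hωB hβB hρ₀]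
    push_cast
    ring
  · push_cast
    ring

lemma hasSum_energyRate (t : ℝ) : HasSum (fun n => opMul (rate (P.ρB ρ₀) t) P.HB n n)
    (P.ωB * (P.imbalance ρ₀ * (deriv P.α t : ℝ))) := by
  have hs : Summable fun n => P.exchDeriv n t := by
    simpa using summable_exchDeriv hωB hβB 0 t
  have h1 := hasSum_nat_mul_sub (P.exchDeriv_zero t) hs.hasSum
    (by simpa using summable_exchDeriv hωB hβB 1 t)
  rw [← deriv_α hωB hβB] at h1
  refine hasSum_of_eq (((Complex.hasSum_ofReal.2 h1).mul_left (P.imbalance ρ₀)).mul_left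
    (P.ωB : ℂ)) (fun n => ?_) rfl
  have hd : HasDerivAt (fun s => P.ρB ρ₀ s n n)
      (P.imbalance ρ₀ * ((P.exchDeriv (n + 1) t - P.exchDeriv n t : ℝ) : ℂ)) t := by
    simp only [ρB_diag hωB hβB hρ₀]
    exact ((((P.hasDerivAt_exch (n + 1) t).sub
      (P.hasDerivAt_exch n t)).ofReal_comp).const_mul _).const_add _
  rw [HB_eq, opMul_diagonal, rate, Matrix.of_apply, hd.deriv]
  push_cast
  ring

lemma EBrate_eq (t : ℝ) : P.EBrate ρ₀ t = P.ωB * (P.imbalance ρ₀ * (deriv P.α t : ℝ)) :=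
  (hasSum_energyRate hωB hβB hρ₀ t).tsum_eq

lemma hasDerivAt_EB (t : ℝ) : HasDerivAt (P.EB ρ₀) (P.EBrate ρ₀ t) t := by
  rw [EBrate_eq hωB hβB hρ₀]
  have h : P.EB ρ₀ = _ := funext fun s => (hasSum_energy hωB hβB hρ₀ s).tsum_eq
  rw [h]
  have hα := (((hasDerivAt_α hωB hβB t).differentiableAt.hasDerivAt.const_sub
    1).ofReal_comp).const_mul (P.imbalance ρ₀)
  refine ((hα.const_sub _).const_mul (P.ωB : ℂ)).congr_deriv ?_
  push_cast
  ring

end thermal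
end Params

/-! ### Diagonal reference states -/

lemma logm_diag {τ : Matrix (Fin 2) (Fin 2) ℂ} (hτ : IsState τ) (hd : τ.IsDiag) :
    (logm τ).IsDiag := by
  rw [logm_eq hτ.1.1 hτ.2]
  intro i j h
  simp [h, hd h]

/-- For a traceless `X`, such as `ρ̇`, a diagonal `Y`, such as `ln τ`, contributes only through the
flow of population and the difference of its two levels. -/
lemma trace_mul_of_isDiag {X Y : Matrix (Fin 2) (Fin 2) ℂ} (hX : X.trace = 0) (hY : Y.IsDiag) :
    (X * Y).trace = X 1 1 * (Y 1 1 - Y 0 0) := by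
  have h01 : Y 0 1 = 0 := hY (by decide)
  have h10 : Y 1 0 = 0 := hY (by decide)
  rw [Matrix.trace_fin_two] at hX ⊢
  simp only [Matrix.mul_apply, Fin.sum_univ_two, h01, h10]
  linear_combination Y 0 0 * hX

namespace Params

variable (P : Params)

/-! ### The generator -/

lemma L_zero_zero (t : ℝ) (X : Matrix (Fin 2) (Fin 2) ℂ) :
    P.L t X 0 0 = P.γ₂ t * X 1 1 - P.γ₁ t * X 0 0 := by
  obtain ⟨a, b, c, d, rfl⟩ : ∃ a b c d, X = !![a, b; c, d] := ⟨_, _, _, _, Matrix.eta_fin_two X⟩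
  simp [L, σp, σm, σz]
  ring

lemma L_one_one (t : ℝ) (X : Matrix (Fin 2) (Fin 2) ℂ) :
    P.L t X 1 1 = P.γ₁ t * X 0 0 - P.γ₂ t * X 1 1 := by
  obtain ⟨a, b, c, d, rfl⟩ : ∃ a b c d, X = !![a, b; c, d] := ⟨_, _, _, _, Matrix.eta_fin_two X⟩
  simp [L, σp, σm, σz]
  ring

lemma L_one_zero (t : ℝ) (X : Matrix (Fin 2) (Fin 2) ℂ) :
    P.L t X 1 0 = deriv P.γ t / P.γ t * X 1 0 := by
  obtain ⟨a, b, c, d, rfl⟩ : ∃ a b c d, X = !![a, b; c, d] := ⟨_, _, _, _, Matrix.eta_fin_two X⟩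
  have h1 : P.L t !![a, b; c, d] 1 0 =
      (-(Complex.I * P.ΩA t) - (P.γ₁ t + P.γ₂ t) / 2 - P.γ₃ t) * c := by
    simp [L, σp, σm, σz]
    ring
  have h2 : -(Complex.I * P.ΩA t) - (P.γ₁ t + P.γ₂ t) / 2 - P.γ₃ t =
      deriv P.γ t / P.γ t := by
    unfold γ₃ ΩA
    generalize deriv P.γ t / P.γ t = w
    apply Complex.ext
    · simp
      ring
    · simp
  rw [h1, h2]
  rfl

lemma L_zero_one (t : ℝ) (X : Matrix (Fin 2) (Fin 2) ℂ) :
    P.L t X 0 1 = star (deriv P.γ t / P.γ t) * X 0 1 := by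
  obtain ⟨a, b, c, d, rfl⟩ : ∃ a b c d, X = !![a, b; c, d] := ⟨_, _, _, _, Matrix.eta_fin_two X⟩
  have h1 : P.L t !![a, b; c, d] 0 1 =
      ((Complex.I * P.ΩA t) - (P.γ₁ t + P.γ₂ t) / 2 - P.γ₃ t) * b := by
    simp [L, σp, σm, σz]
    ring
  have h2 : (Complex.I * P.ΩA t) - (P.γ₁ t + P.γ₂ t) / 2 - P.γ₃ t =
      star (deriv P.γ t / P.γ t) := by
    unfold γ₃ ΩA
    generalize deriv P.γ t / P.γ t = w
    apply Complex.ext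
    · simp
      ring
    · simp
  rw [h1, h2]
  rfl

/-! ### The thermal state of the qubit -/

variable {P} in
lemma wA_eq (hωA : P.ωA ≠ 0) : P.wA =
    Matrix.diagonal ![(((1 + P.boltz)⁻¹ : ℝ) : ℂ), ((P.boltz / (1 + P.boltz) : ℝ) : ℂ)] := by
  have hH : -((P.βB * P.ωB / P.ωA : ℝ) : ℂ) • P.HA =
      Matrix.diagonal ![0, ((-(P.ωB * P.βB) : ℝ) : ℂ)] := by
    have : (P.ωA : ℂ) ≠ 0 := by exact_mod_cast hωA
    ext i j
    fin_cases i <;> fin_cases j <;> simp [HA, σp, σm]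
    field_simp
  have hexp : NormedSpace.exp (![0, ((-(P.ωB * P.βB) : ℝ) : ℂ)] : Fin 2 → ℂ) =
      ![1, (P.boltz : ℂ)] := by
    funext i
    rw [Pi.coe_exp]
    fin_cases i
    · simp
    · simp [boltz, Complex.exp_eq_exp_ℂ]
  have h1 : (1 : ℝ) + P.boltz ≠ 0 := by linarith [P.boltz_pos]
  have h1' : (1 : ℂ) + P.boltz ≠ 0 := by exact_mod_cast h1
  rw [wA, thermalA, hH, Matrix.exp_diagonal, hexp, Matrix.trace_diagonal, Fin.sum_univ_two]
  ext i j
  fin_cases i <;> fin_cases j <;> simp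
  field_simp

variable {P} in
lemma isState_wA (hωA : P.ωA ≠ 0) : IsState P.wA := by
  have hb := P.boltz_pos
  have h1 : (1 : ℝ) + P.boltz ≠ 0 := by linarith
  rw [wA_eq hωA]
  constructor
  · refine Matrix.PosSemidef.diagonal fun i => ?_
    fin_cases i
    · simp only [Fin.zero_eta, Matrix.cons_val_zero, Pi.zero_apply]
      exact Complex.zero_le_real.2 (by positivity)
    · simp only [Fin.mk_one, Matrix.cons_val_one, Pi.zero_apply, Matrix.cons_val_fin_one]
      exact Complex.zero_le_real.2 (by positivity)
  · rw [Matrix.trace_diagonal, Fin.sum_univ_two]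
    simp only [Matrix.cons_val_zero, Matrix.cons_val_one, Matrix.cons_val_fin_one]
    rw [← Complex.ofReal_add, ← Complex.ofReal_one]
    congr 1
    field_simp

variable {P} in
lemma isDiag_wA (hωA : P.ωA ≠ 0) : P.wA.IsDiag := by
  rw [wA_eq hωA]
  exact Matrix.isDiag_diagonal _

section thermal
variable {P} (hωB : 0 < P.ωB) (hβB : 0 < P.βB)
include hωB hβB

lemma logm_wA (hωA : P.ωA ≠ 0) :
    logm P.wA 1 1 - logm P.wA 0 0 = ((-(P.ωB * P.βB) : ℝ) : ℂ) := by
  have hb := P.boltz_pos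
  have hb1 := boltz_lt_one hωB hβB
  have hw := isState_wA hωA
  have hr : bloch P.wA = (1 - P.boltz) / (1 + P.boltz) := by
    rw [bloch, wA_eq hωA]
    simp only [Matrix.diagonal_apply_eq, Matrix.cons_val_zero, Matrix.cons_val_one,
      Matrix.cons_val_fin_one, Complex.ofReal_re, Matrix.diagonal_apply_ne _ one_ne_zero, map_zero,
      mul_zero, add_zero]
    rw [← Real.sqrt_sq (show 0 ≤ (1 - P.boltz) / (1 + P.boltz) from
      div_nonneg (by linarith) (by linarith))]
    congr 1
    field_simp
    ring
  have hr0 : bloch P.wA ≠ 0 := by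
    rw [hr]
    exact div_ne_zero (by linarith) (by linarith)
  have h1 : (1 + bloch P.wA) / 2 = (1 + P.boltz)⁻¹ := by rw [hr]; field_simp; ring
  have h2 : (1 - bloch P.wA) / 2 = P.boltz * (1 + P.boltz)⁻¹ := by rw [hr]; field_simp; ring
  have hslope : logSlope (bloch P.wA) * bloch P.wA = P.ωB * P.βB := by
    rw [logSlope, div_mul_cancel₀ _ hr0, h1, h2, Real.log_mul hb.ne' (by positivity), boltz,
      Real.log_exp]
    ring
  have hdiff : P.boltz / (1 + P.boltz) - (1 + P.boltz)⁻¹ = -bloch P.wA := by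
    rw [hr]; field_simp; ring
  rw [logm_eq hw.1.1 hw.2, ← hslope]
  generalize hs : logSlope (bloch P.wA) = s
  generalize logConst (bloch P.wA) = c
  generalize bloch P.wA = r at hdiff
  rw [wA_eq hωA]
  simp only [Matrix.add_apply, Matrix.smul_apply, Matrix.one_apply_eq, smul_eq_mul, mul_one,
    Matrix.diagonal_apply_eq, Matrix.cons_val_zero, Matrix.cons_val_one, Matrix.cons_val_fin_one]
  rw [show -(s * r) = s * (P.boltz / (1 + P.boltz) - (1 + P.boltz)⁻¹) by rw [hdiff]; ring]
  push_cast
  ring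

/-! ### The rates, the master equation and the fixed points -/

lemma γ₂_eq (t : ℝ) :
    P.γ₂ t = -(deriv P.α t / P.boltz) / (P.α t + P.β t - 1) := by
  have hb := P.boltz_pos
  rw [γ₂, (hasDerivAt_β hωB hβB t).deriv]
  congr 1
  rw [α_eq hωB hβB]
  field_simp
  ring

/-- At `α + β = 1` both sides have the junk value `0`. -/
lemma γ₁_eq (t : ℝ) : P.γ₁ t = P.boltz * P.γ₂ t := by
  have hb := P.boltz_pos
  rw [γ₂_eq hωB hβB, γ₁, (hasDerivAt_β hωB hβB t).deriv, ← mul_div_assoc P.boltz]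
  congr 1
  rw [α_eq hωB hβB]
  field_simp
  ring

lemma rate_ρA_eq_L {t : ℝ} (h : P.Regular t) (ρ₀ : Matrix (Fin 2) (Fin 2) ℂ) :
    rate (P.ρA ρ₀) t = P.L t (P.ρA ρ₀ t) := by
  obtain ⟨h, hγ⟩ := h
  have hb : (P.boltz : ℂ) ≠ 0 := by exact_mod_cast P.boltz_pos.ne'
  have h' : (P.α t : ℂ) + P.β t - 1 ≠ 0 := by exact_mod_cast h
  have hβ : (P.β t : ℂ) = 1 - (1 - P.α t) / P.boltz := by
    rw [β_eq hωB hβB]; push_cast; ring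
  have key : P.γ₁ t * (P.ρA ρ₀ t 0 0) - P.γ₂ t * (P.ρA ρ₀ t 1 1) =
      -(P.imbalance ρ₀ * (deriv P.α t : ℝ)) := by
    have hγ₂ : (P.γ₂ t : ℂ) * (P.boltz * (P.α t + P.β t - 1)) = -(deriv P.α t : ℝ) := by
      rw [γ₂_eq hωB hβB]
      push_cast
      field_simp
    have hX : P.boltz * P.ρA ρ₀ t 0 0 - P.ρA ρ₀ t 1 1 =
        P.imbalance ρ₀ * (P.boltz * (P.α t + P.β t - 1)) := by
      rw [ρA_eq hωB hβB, hβ]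
      simp only [Matrix.of_apply, Matrix.cons_val', Matrix.cons_val_zero, Matrix.cons_val_one,
        Matrix.cons_val_fin_one, imbalance]
      push_cast
      field_simp
      ring
    rw [γ₁_eq hωB hβB]
    push_cast
    linear_combination (P.γ₂ t : ℂ) * hX + P.imbalance ρ₀ * hγ₂
  rw [rate_ρA hωB hβB]
  ext i j
  fin_cases i <;> fin_cases j
  · simp only [Fin.zero_eta, L_zero_zero]
    rw [← neg_sub, key]
    simp
  · simp only [Fin.zero_eta, Fin.mk_one, L_zero_one]
    have : star (P.γ t) ≠ 0 := star_ne_zero.2 hγ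
    rw [ρA_eq hωB hβB]
    simp only [Matrix.of_apply, Matrix.cons_val', Matrix.cons_val_zero, Matrix.cons_val_one,
      Matrix.cons_val_fin_one, star_div₀]
    field_simp
  · simp only [Fin.zero_eta, Fin.mk_one, L_one_zero]
    rw [ρA_eq hωB hβB]
    simp only [Matrix.of_apply, Matrix.cons_val', Matrix.cons_val_zero, Matrix.cons_val_one,
      Matrix.cons_val_fin_one]
    field_simp
  · simp only [Fin.mk_one, L_one_one]
    rw [key]
    simp

lemma isFixedPoint_wA (hωA : P.ωA ≠ 0) (t : ℝ) :
    IsFixedPoint (P.L t) P.wA := by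
  refine ⟨isState_wA hωA, ?_⟩
  have hb := P.boltz_pos
  have h1 : (1 : ℂ) + P.boltz ≠ 0 := by exact_mod_cast (by linarith : (1 : ℝ) + P.boltz ≠ 0)
  have hγ := γ₁_eq hωB hβB t
  ext i j
  fin_cases i <;> fin_cases j
  · simp only [Fin.zero_eta, L_zero_zero, wA_eq hωA, hγ]
    simp
    field_simp
    ring
  · simp [L_zero_one, wA_eq hωA]
  · simp [L_one_zero, wA_eq hωA]
  · simp only [Fin.mk_one, L_one_one, wA_eq hωA, hγ]
    simp
    field_simp
    ring

lemma ρfp_eq_wA (hωA : P.ωA ≠ 0) {t : ℝ} (h2 : P.γ₂ t ≠ 0) :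
    P.ρfp t = P.wA := by
  have hb := P.boltz_pos
  have e1 : P.γ₂ t / (P.γ₁ t + P.γ₂ t) = (1 + P.boltz)⁻¹ := by
    rw [γ₁_eq hωB hβB]; field_simp; ring
  have e2 : P.γ₁ t / (P.γ₁ t + P.γ₂ t) = P.boltz / (1 + P.boltz) := by
    rw [γ₁_eq hωB hβB]; field_simp; ring
  rw [ρfp, wA_eq hωA, e1, e2]

lemma fixedPoint_eq_wA (hωA : P.ωA ≠ 0) {t : ℝ} (h2 : P.γ₂ t ≠ 0)
    {τ : Matrix (Fin 2) (Fin 2) ℂ} (hτ : IsFixedPoint (P.L t) τ) (hd : τ.IsDiag) : τ = P.wA := by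
  have hb := P.boltz_pos
  have h1 : (1 : ℂ) + P.boltz ≠ 0 := by exact_mod_cast (by linarith : (1 : ℝ) + P.boltz ≠ 0)
  have h2' : (P.γ₂ t : ℂ) ≠ 0 := by exact_mod_cast h2
  have e1 : P.L t τ 1 1 = 0 := by rw [hτ.2]; rfl
  have e2 := hτ.1.2
  rw [L_one_one, γ₁_eq hωB hβB] at e1
  rw [Matrix.trace_fin_two] at e2
  have e3 : P.boltz * τ 0 0 = τ 1 1 := by
    refine mul_left_cancel₀ h2' ?_
    push_cast at e1
    linear_combination e1
  have e4 : τ 0 0 = (1 + P.boltz : ℂ)⁻¹ := by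
    rw [← mul_eq_one_iff_eq_inv₀ h1]; linear_combination e2 + e3
  rw [wA_eq hωA]
  ext i j
  fin_cases i <;> fin_cases j
  · simp [e4]
  · simpa using hd (by decide : (0 : Fin 2) ≠ 1)
  · simpa using hd (by decide : (1 : Fin 2) ≠ 0)
  · simp [← e3, e4, div_eq_mul_inv]

omit hωB hβB in
lemma isDiag_of_isFixedPoint {t : ℝ} (hγ : P.γ t ≠ 0) (hγ' : deriv P.γ t ≠ 0)
    {τ : Matrix (Fin 2) (Fin 2) ℂ} (hτ : IsFixedPoint (P.L t) τ) : τ.IsDiag := by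
  have e1 : P.L t τ 1 0 = 0 := by rw [hτ.2]; rfl
  have e2 : P.L t τ 0 1 = 0 := by rw [hτ.2]; rfl
  have hne : deriv P.γ t / P.γ t ≠ 0 := div_ne_zero hγ' hγ
  rw [L_one_zero, mul_eq_zero, or_iff_right hne] at e1
  rw [L_zero_one, mul_eq_zero, or_iff_right (star_ne_zero.2 hne)] at e2
  intro i j hij
  fin_cases i <;> fin_cases j <;> first | exact e1 | exact e2 | exact absurd rfl hij

/-! ### Entropy production -/

variable {ρ₀ : Matrix (Fin 2) (Fin 2) ℂ} (hρ₀ : IsState ρ₀)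
include hρ₀

lemma hasDerivAt_entropy_ρA {t : ℝ} (hpos : (P.ρA ρ₀ t).PosDef) :
    HasDerivAt (fun s => entropy (P.ρA ρ₀ s))
      (-(rate (P.ρA ρ₀) t * logm (P.ρA ρ₀ t)).trace) t :=
  hasDerivAt_entropy (isHermitian_ρA hωB hβB hρ₀) (trace_ρA hωB hβB hρ₀)
    (fun s i j => (hasDerivAt_ρA hωB hβB ρ₀ s i j).differentiableAt) hpos

omit hρ₀ in
/-- The rate relative to a diagonal `τ` differs from `Ṡ_A` by the flow of population. -/
lemma σfp_eq (ρ₀ : Matrix (Fin 2) (Fin 2) ℂ) {τ : Matrix (Fin 2) (Fin 2) ℂ} (hτ : IsState τ)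
    (hd : τ.IsDiag) (t : ℝ) :
    P.σfp ρ₀ τ t = -(rate (P.ρA ρ₀) t * logm (P.ρA ρ₀ t)).trace +
      rate (P.ρA ρ₀) t 1 1 * (logm τ 1 1 - logm τ 0 0) := by
  have h0 : (rate (P.ρA ρ₀) t).trace = 0 := by
    rw [rate_ρA hωB hβB, Matrix.trace_fin_two]; simp
  rw [σfp, mul_sub, Matrix.trace_sub, trace_mul_of_isDiag h0 (logm_diag hτ hd)]
  ring

lemma σEs_eq_σfp_wA (hωA : P.ωA ≠ 0) {t : ℝ} (hpos : (P.ρA ρ₀ t).PosDef) :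
    P.σEs ρ₀ t = P.σfp ρ₀ P.wA t := by
  rw [σEs, (hasDerivAt_entropy_ρA hωB hβB hρ₀ hpos).deriv, EBrate_eq hωB hβB hρ₀,
    σfp_eq hωB hβB ρ₀ (isState_wA hωA) (isDiag_wA hωA), logm_wA hωB hβB hωA, rate_ρA hωB hβB]
  simp
  ring

/-- If `γ₂ = 0`, the populations are momentarily at rest, so that every diagonal `τ` gives the same
rate; otherwise `τ = w_A`. -/
lemma σEs_eq_σfp (hωA : P.ωA ≠ 0) {t : ℝ} (h : P.Regular t) (hpos : (P.ρA ρ₀ t).PosDef)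
    {τ : Matrix (Fin 2) (Fin 2) ℂ} (hτ : IsFixedPoint (P.L t) τ) (hd : τ.IsDiag) :
    P.σEs ρ₀ t = P.σfp ρ₀ τ t := by
  rw [σEs_eq_σfp_wA hωB hβB hρ₀ hωA hpos]
  by_cases h2 : P.γ₂ t = 0
  · have hr : rate (P.ρA ρ₀) t 1 1 = 0 := by
      rw [rate_ρA_eq_L hωB hβB h, L_one_one, γ₁_eq hωB hβB, h2]
      simp
    rw [σfp_eq hωB hβB ρ₀ (isState_wA hωA) (isDiag_wA hωA), σfp_eq hωB hβB ρ₀ hτ.1 hd, hr]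
    simp
  · rw [fixedPoint_eq_wA hωB hβB hωA h2 hτ hd]

end thermal
end Params

end JC

end

theorem mainTheorem2 (P : JC.Params) (hωA : P.ωA ≠ 0) (hωB : 0 < P.ωB) (hβB : 0 < P.βB)
    (ρ₀ : Matrix (Fin 2) (Fin 2) ℂ) (hρ₀ : JC.IsState ρ₀) :
    -- all series converge and all derivatives exist
    ((∀ (t : ℝ) (i j : Fin 2 × ℕ),
        Summable (JC.opExpTerm (-(Complex.I * t) • P.HAB) i j)) ∧
      (∀ i j : ℕ, Summable (JC.opExpTerm (-(P.βB : ℂ) • P.HB) i j)) ∧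
      (Summable fun n : ℕ => JC.opExp (-(P.βB : ℂ) • P.HB) n n) ∧
      (∀ (t : ℝ) (i j : Fin 2), Summable fun n : ℕ => P.ρAB ρ₀ t (i, n) (j, n)) ∧
      (∀ (t : ℝ) (i j : Fin 2), DifferentiableAt ℝ (fun s => P.ρA ρ₀ s i j) t) ∧
      (∀ (t : ℝ) (m n : ℕ), DifferentiableAt ℝ (fun s => P.ρB ρ₀ s m n) t) ∧
      (∀ t : ℝ, Summable fun n : ℕ => JC.opMul (P.ρB ρ₀ t) P.HB n n) ∧
      (∀ t : ℝ, Summable fun n : ℕ => JC.opMul (JC.rate (P.ρB ρ₀) t) P.HB n n) ∧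
      (∀ t : ℝ, HasDerivAt (P.EB ρ₀) (P.EBrate ρ₀ t) t) ∧
      (∀ t : ℝ, (P.ρA ρ₀ t).PosDef →
        DifferentiableAt ℝ (fun s => JC.entropy (P.ρA ρ₀ s)) t) ∧
      Differentiable ℝ P.α ∧ Differentiable ℝ P.β ∧ Differentiable ℝ P.γ) ∧
    -- `𝓛_t` generates the dynamics of the qubit
    (∀ t : ℝ, P.Regular t → ∀ i j : Fin 2,
      HasDerivAt (fun s => P.ρA ρ₀ s i j) (P.L t (P.ρA ρ₀ t) i j) t) ∧
    -- the ratio of the rates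
    (∀ t : ℝ, P.α t + P.β t - 1 ≠ 0 →
      P.γ₁ t = Real.exp (-(P.ωB * P.βB)) * P.γ₂ t ∧
      (P.γ₂ t ≠ 0 → P.γ₁ t / P.γ₂ t = Real.exp (-(P.ωB * P.βB)))) ∧
    -- the instantaneous fixed point
    (∀ t : ℝ, P.Regular t →
      JC.IsFixedPoint (P.L t) P.wA ∧
      (P.γ₂ t ≠ 0 → P.ρfp t = P.wA) ∧
      (P.γ₂ t ≠ 0 → ∀ τ, JC.IsFixedPoint (P.L t) τ → τ.IsDiag → τ = P.wA) ∧
      (deriv P.γ t ≠ 0 → ∀ τ, JC.IsFixedPoint (P.L t) τ → τ.IsDiag)) ∧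
    -- equality of the entropy production rates
    (∀ t : ℝ, (P.ρA ρ₀ t).PosDef → P.σEs ρ₀ t = P.σfp ρ₀ P.wA t) ∧
    (∀ t : ℝ, P.Regular t → (P.ρA ρ₀ t).PosDef →
      ∀ τ, JC.IsFixedPoint (P.L t) τ → τ.IsDiag → τ.PosDef →
        P.σEs ρ₀ t = P.σfp ρ₀ τ t) := by
  open JC JC.Params in
  refine ⟨⟨fun t i j => (P.hasSum_U t i j).summable,
    fun i j => (P.hasSum_opExp_HB i j).summable, ?_,
    fun t i j => (hasSum_ρAB hωB hβB ρ₀ t i j).summable,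
    fun t i j => (hasDerivAt_ρA hωB hβB ρ₀ t i j).differentiableAt, fun t m n => ?_,
    fun t => (hasSum_energy hωB hβB hρ₀ t).summable,
    fun t => (hasSum_energyRate hωB hβB hρ₀ t).summable, hasDerivAt_EB hωB hβB hρ₀,
    fun t h => (hasDerivAt_entropy_ρA hωB hβB hρ₀ h).differentiableAt,
    fun t => (hasDerivAt_α hωB hβB t).differentiableAt,
    fun t => (hasDerivAt_β hωB hβB t).differentiableAt, differentiable_γ hωB hβB⟩,
    fun t h i j => ?_, fun t h => ?_, fun t h => ⟨isFixedPoint_wA hωB hβB hωA t,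
      ρfp_eq_wA hωB hβB hωA, fun h2 τ => fixedPoint_eq_wA hωB hβB hωA h2,
      fun h2 τ => isDiag_of_isFixedPoint h.2 h2⟩,
    fun t => σEs_eq_σfp_wA hωB hβB hρ₀ hωA,
    fun t h hpos τ hτ hd _ => σEs_eq_σfp hωB hβB hρ₀ hωA h hpos hτ hd⟩
  · rw [opExp_HB_eq]
    simp only [Matrix.diagonal_apply_eq]
    exact Complex.summable_ofReal.2 (hasSum_boltz_pow hωB hβB).summable
  · simp only [ρB, traceA, Matrix.of_apply, Fin.sum_univ_two]
    exact ((differentiable_ρAB hωB hβB ρ₀ _ _).add (differentiable_ρAB hωB hβB ρ₀ _ _)) t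
  · rw [← rate_ρA_eq_L hωB hβB h]
    exact (hasDerivAt_ρA hωB hβB ρ₀ t i j).differentiableAt.hasDerivAt
  · have e := γ₁_eq hωB hβB t
    refine ⟨e, fun h2 => ?_⟩
    rw [e, mul_div_cancel_right₀ _ h2]
    rfl
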